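/- Let $k$ be a commutative ring and $d,m,n\ge 0$ integers. Let $\Gamma^dP_k$ be the category whose objects are the finitely generated projective $k$-modules, with $\mathrm{Hom}(V,W)=\Gamma^d(\mathrm{Hom}_k(V,W))$, where $\Gamma^d(M)=(M^{\otimes d})^{S_d}$, and composition induced by composition of linear maps in each tensor factor. Let $\mathrm{Rep}\,\Gamma^d_k$ be the category of strict polynomial functors of degree $d$, i.e. of $k$-linear functors $\Gamma^dP_k\to k\text{-Mod}$. The internal tensor product $X\,\underline{\otimes}\,Y$ of two such functors is the Day convolution $$(X\,\underline{\otimes}\,Y)(U)=\int^{V,W}\mathrm{Hom}_{\Gamma^dP_k}(V\otimes W,U)\otimes_k X(V)\otimes_k Y(W),$$ a $k$-linear coend over $\Gamma^dP_k$. Let $\Lambda(n,d)$ be the set of sequences of $n$ non-negative integers with sum $d$. For $\lambda=(\lambda_1,\dots,\lambda_n)\in\Lambda(n,d)$ put $\Gamma^\lambda=\Gamma^{\lambda_1}\otimes\cdots\otimes\Gamma^{\lambda_n}$, $\mathrm{Sym}^\lambda=\mathrm{Sym}^{\lambda_1}\otimes\cdots\otimes\mathrm{Sym}^{\lambda_n}$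 and $\wedge^\lambda=\wedge^{\lambda_1}\otimes\cdots\otimes\wedge^{\lambda_n}$ (tensor products of divided, symmetric and exterior powers) in $\mathrm{Rep}\,\Gamma^d_k$, and let $M^\lambda=k[S_d/S_\lambda]$ be the permutation module of the Young subgroup $S_\lambda\subseteq S_d$. Let $\lambda\in\Lambda(m,d)$ and $\mu\in\Lambda(n,d)$, and let $S$ be the set of $n\times m$ matrices with non-negative integer entries, row sums $\mu$ and column sums $\lambda$; listing the entries row by row, each element of $S$ gives some $\nu\in\Lambda(mn,d)$. Then in $\mathrm{Rep}\,\Gamma^d_k$ $$\Gamma^\lambda\,\underline{\otimes}\,\wedge^\mu\simeq\bigoplus_{\nu\in S}\wedge^\nu,\qquad \Gamma^\lambda\,\underline{\otimes}\,\mathrm{Sym}^\mu\simeq\wedge^\lambda\,\underline{\otimes}\,\wedge^\mu\simeq\mathrm{Sym}^\lambda\,\underline{\otimes}\,\mathrm{Sym}^\mu\simeq\bigoplus_{\nu\in S}\mathrm{Sym}^\nu,$$ $$\mathrm{Sym}^\lambda\,\underline{\otimes}\,\wedge^\mu\simeq\bigoplus_{\nu\in S}\wedge^\nu\ \text{ if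 $2$ is a unit in $k$},\qquad \mathrm{Sym}^\lambda\,\underline{\otimes}\,\wedge^\mu\simeq\bigoplus_{\nu\in S}\mathrm{Sym}^\nu\ \text{ if $2=0$ in $k$}.$$ Moreover, $M^\mu\otimes_k M^\lambda\simeq\bigoplus_{\nu\in S}M^\nu$ as $kS_d$-modules, with $S_d$ acting diagonally on the left-hand side. -/

import Mathlib

open CategoryTheory
open scoped TensorProduct

universe u

namespace StrictPoly

noncomputable section

/-! ## Tensor powers with their symmetric group action, and divided powers -/

/-- The tensor power `M^{⊗ d}`. -/
abbrev TPow (k : Type u) [CommRing k] (d : ℕ) (M : Type u) [AddCommGroup M] [Module k M] : Type u :=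
  PiTensorProduct k (fun _ : Fin d => M)

/-- The place permutation action of the symmetric group on `M^{⊗ d}`:
`σ • (x₁ ⊗ ⋯ ⊗ x_d)` has the factor `x_{σ⁻¹ i}` in the place `i`. -/
def perm (k : Type u) [CommRing k] {d : ℕ} {M : Type u} [AddCommGroup M] [Module k M]
    (σ : Equiv.Perm (Fin d)) : TPow k d M →ₗ[k] TPow k d M :=
  (PiTensorProduct.reindex k (fun _ : Fin d => M) σ).toLinearMap

/-- The tensors invariant under a subgroup `G` of the symmetric group. -/
def invariants (k : Type u) [CommRing k] {d : ℕ} (G : Subgroup (Equiv.Perm (Fin d)))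
    (M : Type u) [AddCommGroup M] [Module k M] : Submodule k (TPow k d M) where
  carrier := {t | ∀ σ ∈ G, perm k σ t = t}
  add_mem' ha hb σ hσ := by rw [map_add, ha σ hσ, hb σ hσ]
  zero_mem' σ _ := map_zero _
  smul_mem' c t ht σ hσ := by rw [map_smul, ht σ hσ]

/-- The divided power `Γ^d(M) = (M^{⊗ d})^{S_d}`. -/
abbrev DPow (k : Type u) [CommRing k] (d : ℕ) (M : Type u) [AddCommGroup M] [Module k M] :
    Submodule k (TPow k d M) :=
  invariants k ⊤ M

section Lemmas

variable {k : Type u} [CommRing k] {d : ℕ}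
variable {M N P Q : Type u} [AddCommGroup M] [Module k M] [AddCommGroup N] [Module k N]
  [AddCommGroup P] [Module k P] [AddCommGroup Q] [Module k Q]

@[simp] lemma perm_tprod (σ : Equiv.Perm (Fin d)) (x : Fin d → M) :
    perm k σ (PiTensorProduct.tprod k x) = PiTensorProduct.tprod k (fun i => x (σ.symm i)) :=
  PiTensorProduct.reindex_tprod σ x

/-- The bilinear map `M^{⊗ d} × N^{⊗ d} → P^{⊗ d}` given by a bilinear map `M × N → P` in every
place. -/
def place₂ (d : ℕ) (b : M →ₗ[k] N →ₗ[k] P) : TPow k d M →ₗ[k] TPow k d N →ₗ[k] TPow k d P :=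
  PiTensorProduct.map₂ (fun _ => b)

@[simp] lemma place₂_tprod (b : M →ₗ[k] N →ₗ[k] P) (x : Fin d → M) (y : Fin d → N) :
    place₂ d b (PiTensorProduct.tprod k x) (PiTensorProduct.tprod k y) =
      PiTensorProduct.tprod k (fun i => b (x i) (y i)) :=
  PiTensorProduct.map₂_tprod_tprod _ _ _

lemma tpow_induction {p : TPow k d M → Prop} (t : TPow k d M)
    (h : ∀ x : Fin d → M, p (PiTensorProduct.tprod k x))
    (hs : ∀ (c : k) t, p t → p (c • t)) (ha : ∀ s t, p s → p t → p (s + t)) : p t := by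
  induction t using PiTensorProduct.induction_on with
  | smul_tprod r x => exact hs _ _ (h x)
  | add s t h₁ h₂ => exact ha _ _ h₁ h₂

lemma perm_place₂ (σ : Equiv.Perm (Fin d)) (b : M →ₗ[k] N →ₗ[k] P) (s : TPow k d M)
    (t : TPow k d N) : perm k σ (place₂ d b s t) = place₂ d b (perm k σ s) (perm k σ t) := by
  induction s using tpow_induction with
  | h x =>
    induction t using tpow_induction with
    | h y => simp
    | hs c t h => simp [h]
    | ha s t h₁ h₂ => simp [h₁, h₂]
  | hs c t h => simp [h]
  | ha s t h₁ h₂ => simp [h₁, h₂]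

lemma place₂_mem (b : M →ₗ[k] N →ₗ[k] P) {G : Subgroup (Equiv.Perm (Fin d))} {s : TPow k d M}
    {t : TPow k d N} (hs : s ∈ invariants k G M) (ht : t ∈ invariants k G N) :
    place₂ d b s t ∈ invariants k G P := fun σ hσ => by
  rw [perm_place₂, hs σ hσ, ht σ hσ]

lemma diag_mem (x : M) : PiTensorProduct.tprod k (fun _ : Fin d => x) ∈ DPow k d M :=
  fun σ _ => by simp

/-- Composition `Hom(N, P)^{⊗ d} × Hom(M, N)^{⊗ d} → Hom(M, P)^{⊗ d}`, place by place. -/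
def compT : TPow k d (N →ₗ[k] P) →ₗ[k] TPow k d (M →ₗ[k] N) →ₗ[k] TPow k d (M →ₗ[k] P) :=
  place₂ d (LinearMap.llcomp k M N P)

/-- The action `Hom(M, N)^{⊗ d} × M^{⊗ d} → N^{⊗ d}`, place by place. -/
def actT : TPow k d (M →ₗ[k] N) →ₗ[k] TPow k d M →ₗ[k] TPow k d N :=
  place₂ d LinearMap.id

/-- The tensor product `Hom(M, N)^{⊗ d} × Hom(P, Q)^{⊗ d} → Hom(M ⊗ P, N ⊗ Q)^{⊗ d}`, place by
place. -/
def tensT : TPow k d (M →ₗ[k] N) →ₗ[k] TPow k d (P →ₗ[k] Q) →ₗ[k]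
    TPow k d ((M ⊗[k] P) →ₗ[k] (N ⊗[k] Q)) :=
  place₂ d (LinearMap.mk₂ k TensorProduct.map TensorProduct.map_add_left
    TensorProduct.map_smul_left TensorProduct.map_add_right TensorProduct.map_smul_right)

@[simp] lemma compT_tprod (f : Fin d → N →ₗ[k] P) (g : Fin d → M →ₗ[k] N) :
    compT (PiTensorProduct.tprod k f) (PiTensorProduct.tprod k g) =
      PiTensorProduct.tprod k (fun i => f i ∘ₗ g i) := place₂_tprod _ _ _

@[simp] lemma actT_tprod (f : Fin d → M →ₗ[k] N) (x : Fin d → M) :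
    actT (PiTensorProduct.tprod k f) (PiTensorProduct.tprod k x) =
      PiTensorProduct.tprod k (fun i => f i (x i)) := place₂_tprod _ _ _

@[simp] lemma tensT_tprod (f : Fin d → M →ₗ[k] N) (g : Fin d → P →ₗ[k] Q) :
    tensT (PiTensorProduct.tprod k f) (PiTensorProduct.tprod k g) =
      PiTensorProduct.tprod k (fun i => TensorProduct.map (f i) (g i)) := place₂_tprod _ _ _

/-- The identity of `M`, in every place. -/
def idT (k : Type u) [CommRing k] (d : ℕ) (M : Type u) [AddCommGroup M] [Module k M] :
    TPow k d (M →ₗ[k] M) :=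
  PiTensorProduct.tprod k (fun _ => LinearMap.id)

lemma compT_idT (f : TPow k d (M →ₗ[k] N)) : compT f (idT k d M) = f := by
  induction f using tpow_induction with
  | h x => simp [idT]
  | hs c t h => simp [h]
  | ha s t h₁ h₂ => simp [h₁, h₂]

lemma idT_compT (f : TPow k d (M →ₗ[k] N)) : compT (idT k d N) f = f := by
  induction f using tpow_induction with
  | h x => simp [idT]
  | hs c t h => simp [h]
  | ha s t h₁ h₂ => simp [h₁, h₂]

lemma compT_assoc (h : TPow k d (P →ₗ[k] Q)) (g : TPow k d (N →ₗ[k] P))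
    (f : TPow k d (M →ₗ[k] N)) : compT (compT h g) f = compT h (compT g f) := by
  induction h using tpow_induction with
  | h x =>
    induction g using tpow_induction with
    | h y =>
      induction f using tpow_induction with
      | h z => simp [LinearMap.comp_assoc]
      | hs c t h => simp only [map_smul, h]
      | ha s t h₁ h₂ => simp only [map_add, h₁, h₂]
    | hs c t h => simp only [map_smul, LinearMap.smul_apply, h]
    | ha s t h₁ h₂ => simp only [map_add, LinearMap.add_apply, h₁, h₂]
  | hs c t h => simp only [map_smul, LinearMap.smul_apply, h]
  | ha s t h₁ h₂ => simp only [map_add, LinearMap.add_apply, h₁, h₂]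

lemma actT_idT (t : TPow k d M) : actT (idT k d M) t = t := by
  induction t using tpow_induction with
  | h x => simp [idT]
  | hs c t h => simp [h]
  | ha s t h₁ h₂ => simp [h₁, h₂]

lemma actT_compT (g : TPow k d (N →ₗ[k] P)) (f : TPow k d (M →ₗ[k] N)) (t : TPow k d M) :
    actT (compT g f) t = actT g (actT f t) := by
  induction g using tpow_induction with
  | h x =>
    induction f using tpow_induction with
    | h y =>
      induction t using tpow_induction with
      | h z => simp
      | hs c t h => simp only [map_smul, h]
      | ha s t h₁ h₂ => simp only [map_add, h₁, h₂]
    | hs c t h => simp only [map_smul, LinearMap.smul_apply, h]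
    | ha s t h₁ h₂ => simp only [map_add, LinearMap.add_apply, h₁, h₂]
  | hs c t h => simp only [map_smul, LinearMap.smul_apply, h]
  | ha s t h₁ h₂ => simp only [map_add, LinearMap.add_apply, h₁, h₂]

lemma perm_actT {f : TPow k d (M →ₗ[k] N)} (hf : f ∈ DPow k d (M →ₗ[k] N))
    (σ : Equiv.Perm (Fin d)) (t : TPow k d M) :
    perm k σ (actT f t) = actT f (perm k σ t) := by
  rw [actT, perm_place₂, hf σ trivial]

end Lemmas

/-! ## The divided power category -/

/-- Objects of the divided power category `Γ^d P_k`: finitely generated projective `k`-modules. -/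
structure DivCat (k : Type u) [CommRing k] (d : ℕ) : Type (u + 1) where
  carrier : Type u
  [addCommGroup : AddCommGroup carrier]
  [module : Module k carrier]
  [finite : Module.Finite k carrier]
  [projective : Module.Projective k carrier]

attribute [instance] DivCat.addCommGroup DivCat.module DivCat.finite DivCat.projective

variable {k : Type u} [CommRing k] {d : ℕ}

/-- `Γ^d P_k`: the morphisms are `Hom(V, W) = Γ^d(Hom_k(V, W))`, composed place by place. -/
instance : Category.{u} (DivCat k d) where
  Hom V W := DPow k d (V.carrier →ₗ[k] W.carrier)
  id V := ⟨idT k d V.carrier, diag_mem _⟩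
  comp f g := ⟨compT g.1 f.1, place₂_mem _ g.2 f.2⟩
  id_comp f := Subtype.ext (compT_idT f.1)
  comp_id f := Subtype.ext (idT_compT f.1)
  assoc f g h := Subtype.ext (compT_assoc h.1 g.1 f.1).symm

instance : Preadditive (DivCat k d) where
  homGroup V W := inferInstanceAs (AddCommGroup (DPow k d (V.carrier →ₗ[k] W.carrier)))
  add_comp _ _ _ f f' g := Subtype.ext (map_add (compT g.1) f.1 f'.1)
  comp_add _ _ _ f g g' := Subtype.ext (LinearMap.map_add₂ compT g.1 g'.1 f.1)

instance : Linear k (DivCat k d) where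
  homModule V W := inferInstanceAs (Module k (DPow k d (V.carrier →ₗ[k] W.carrier)))
  smul_comp _ _ _ r f g := Subtype.ext (map_smul (compT g.1) r f.1)
  comp_smul _ _ _ f r g := Subtype.ext (LinearMap.map_smul₂ compT r g.1 f.1)

namespace DivCat

/-- The underlying element of `Hom_k(V, W)^{⊗ d}` of a morphism. -/
def val {V W : DivCat k d} : (V ⟶ W) →ₗ[k] TPow k d (V.carrier →ₗ[k] W.carrier) :=
  (DPow k d (V.carrier →ₗ[k] W.carrier)).subtype

lemma val_mem {V W : DivCat k d} (f : V ⟶ W) :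
    val f ∈ DPow k d (V.carrier →ₗ[k] W.carrier) := f.2

lemma val_injective {V W : DivCat k d} {f g : V ⟶ W} (h : val f = val g) : f = g := Subtype.ext h

@[simp] lemma val_id (V : DivCat k d) : val (𝟙 V) = idT k d V.carrier := rfl

@[simp] lemma val_comp {U V W : DivCat k d} (f : U ⟶ V) (g : V ⟶ W) :
    val (f ≫ g) = compT (val g) (val f) := rfl

/-- The morphism `f ⊗ ⋯ ⊗ f` given by a linear map `f`. -/
def diag {V W : DivCat k d} (f : V.carrier →ₗ[k] W.carrier) : V ⟶ W :=
  ⟨PiTensorProduct.tprod k (fun _ => f), diag_mem f⟩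

/-- The tensor product of `Γ^d P_k` on objects. -/
def tensor (V W : DivCat k d) : DivCat k d where
  carrier := V.carrier ⊗[k] W.carrier

/-- The tensor product of `Γ^d P_k` on morphisms. -/
def tensorHom {V V' W W' : DivCat k d} (f : V ⟶ V') (g : W ⟶ W') :
    V.tensor W ⟶ V'.tensor W' :=
  ⟨tensT (val f) (val g), place₂_mem _ f.2 g.2⟩

/-- The free module `k^n`. -/
def free (k : Type u) [CommRing k] (d n : ℕ) : DivCat k d where
  carrier := Fin n → k

lemma exists_retract (V : DivCat k d) :
    ∃ (n : ℕ) (i : V ⟶ free k d n) (p : free k d n ⟶ V), i ≫ p = 𝟙 V := by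
  obtain ⟨n, f, g, -, -, h⟩ := Module.Finite.exists_comp_eq_id_of_projective k V.carrier
  refine ⟨n, diag (W := free k d n) g, diag (V := free k d n) f, val_injective ?_⟩
  change compT (PiTensorProduct.tprod k (fun _ : Fin d => f))
    (PiTensorProduct.tprod k (fun _ => g)) = _
  rw [compT_tprod, h]
  rfl

end DivCat

/-! ## Strict polynomial functors -/

/-- The category `Rep Γ^d_k` of strict polynomial functors of degree `d`: the `k`-linear functors
from `Γ^d P_k` to `k`-modules, with all natural transformations. -/
abbrev SPF (k : Type u) [CommRing k] (d : ℕ) :=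
  ObjectProperty.FullSubcategory
    (fun F : DivCat k d ⥤ ModuleCat.{u} k => F.Additive ∧ F.Linear k)

/-- A strict polynomial functor from its values and its linear action on morphisms. -/
def SPF.of (obj : DivCat k d → Type u) [∀ V, AddCommGroup (obj V)] [∀ V, Module k (obj V)]
    (map : ∀ {V W : DivCat k d}, (V ⟶ W) →ₗ[k] (obj V →ₗ[k] obj W))
    (map_id : ∀ (V : DivCat k d) (x : obj V), map (𝟙 V) x = x)
    (map_comp : ∀ {U V W : DivCat k d} (f : U ⟶ V) (g : V ⟶ W) (x : obj U),
      map (f ≫ g) x = map g (map f x)) : SPF k d where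
  obj :=
    { obj := fun V => ModuleCat.of k (obj V)
      map := fun f => ModuleCat.ofHom (map f)
      map_id := fun V => by ext x; exact map_id V x
      map_comp := fun f g => by ext x; exact map_comp f g x }
  property := ⟨⟨fun {V W f g} => by ext x; exact LinearMap.congr_fun (map_add map f g) x⟩,
    ⟨fun f r => by ext x; exact LinearMap.congr_fun (map_smul map r f) x⟩⟩

namespace SPF

/-- The value `X(V)`. -/
abbrev val (X : SPF k d) (V : DivCat k d) : Type u := X.obj.obj V

/-- The action of a morphism of `Γ^d P_k`. -/
abbrev act (X : SPF k d) {V W : DivCat k d} (f : V ⟶ W) : X.val V →ₗ[k] X.val W :=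
  (X.obj.map f).hom

/-- The action on morphisms, as a linear map. -/
def actₗ (X : SPF k d) {V W : DivCat k d} : (V ⟶ W) →ₗ[k] (X.val V →ₗ[k] X.val W) where
  toFun f := X.act f
  map_add' f g := by
    have := X.property.1
    simp [act, Functor.map_add]
  map_smul' r f := by
    have := X.property.2
    simp [act, Functor.map_smul]

lemma act_id (X : SPF k d) (V : DivCat k d) (x : X.val V) : X.act (𝟙 V) x = x := by
  simp [act]

lemma act_comp (X : SPF k d) {U V W : DivCat k d} (f : U ⟶ V) (g : V ⟶ W) (x : X.val U) :
    X.act (f ≫ g) x = X.act g (X.act f x) := by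
  simp [act]

/-- The direct sum of a family of strict polynomial functors, computed pointwise. -/
def directSum {ι : Type} (X : ι → SPF k d) : SPF k d :=
  SPF.of (fun V => DirectSum ι fun i => (X i).val V)
    (fun {V W} =>
      { toFun := fun f => DirectSum.lmap fun i => (X i).actₗ f
        map_add' := fun f g => by
          classical
          refine DirectSum.linearMap_ext k fun i => ?_
          ext x : 1
          simp [DirectSum.lmap_lof]
        map_smul' := fun r f => by
          classical
          refine DirectSum.linearMap_ext k fun i => ?_
          ext x : 1
          simp [DirectSum.lmap_lof] })
    (fun V x => by
      have : DirectSum.lmap (fun i => (X i).act (𝟙 V)) = LinearMap.id := by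
        ext i x : 2
        simp [act_id]
      exact LinearMap.congr_fun this x)
    (fun {U V W} f g x => by
      have : DirectSum.lmap (fun i => (X i).act (f ≫ g)) =
          DirectSum.lmap (fun i => (X i).act g) ∘ₗ DirectSum.lmap (fun i => (X i).act f) := by
        ext i x : 2
        simp [act_comp]
      exact LinearMap.congr_fun this x)

/-! ### The internal tensor product -/

/-- The summands `Hom(V ⊗ W, U) ⊗ X(V) ⊗ Y(W)` of the coend, for all `V`, `W` in `Γ^d P_k`. -/
abbrev CoendSum (X Y : SPF k d) (U : DivCat k d) : Type (u + 1) :=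
  DirectSum (DivCat k d × DivCat k d) fun p =>
    (p.1.tensor p.2 ⟶ U) ⊗[k] (X.val p.1 ⊗[k] Y.val p.2)

/-- The element `φ ⊗ x ⊗ y` of the summand of `V`, `W`. -/
def coendι (X Y : SPF k d) {U : DivCat k d} (V W : DivCat k d) (φ : V.tensor W ⟶ U)
    (x : X.val V) (y : Y.val W) : CoendSum X Y U :=
  open scoped Classical in
  DirectSum.lof k (DivCat k d × DivCat k d)
    (fun p => (p.1.tensor p.2 ⟶ U) ⊗[k] (X.val p.1 ⊗[k] Y.val p.2)) (V, W) (φ ⊗ₜ (x ⊗ₜ y))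

/-- The relations `(φ ∘ (g ⊗ h)) ⊗ x ⊗ y ∼ φ ⊗ X(g)(x) ⊗ Y(h)(y)` of the coend. -/
def coendRel (X Y : SPF k d) (U : DivCat k d) : Submodule k (CoendSum X Y U) :=
  Submodule.span k {t | ∃ (V V' W W' : DivCat k d) (g : V ⟶ V') (h : W ⟶ W')
    (φ : V'.tensor W' ⟶ U) (x : X.val V) (y : Y.val W),
    t = coendι X Y V W (DivCat.tensorHom g h ≫ φ) x y -
      coendι X Y V' W' φ (X.act g x) (Y.act h y)}

/-- The coend `∫^{V, W} Hom(V ⊗ W, U) ⊗ X(V) ⊗ Y(W)` over `Γ^d P_k`. -/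
abbrev Coend (X Y : SPF k d) (U : DivCat k d) : Type (u + 1) := CoendSum X Y U ⧸ coendRel X Y U

lemma coendSum_hom_ext {X Y : SPF k d} {U : DivCat k d} {M : Type*} [AddCommGroup M] [Module k M]
    {f g : CoendSum X Y U →ₗ[k] M}
    (h : ∀ V W φ x y, f (coendι X Y V W φ x y) = g (coendι X Y V W φ x y)) : f = g := by
  classical
  refine DirectSum.linearMap_ext k fun p => ?_
  refine TensorProduct.ext' fun φ z => ?_
  induction z using TensorProduct.induction_on with
  | zero => simp
  | tmul x y =>
    have := h p.1 p.2 φ x y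
    simpa only [coendι, LinearMap.comp_apply, Subsingleton.elim (Classical.decEq _)] using this
  | add a b ha hb => rw [TensorProduct.tmul_add, map_add, map_add, ha, hb]

lemma coend_hom_ext {X Y : SPF k d} {U : DivCat k d} {M : Type*} [AddCommGroup M] [Module k M]
    {f g : Coend X Y U →ₗ[k] M}
    (h : ∀ V W φ x y, f ((coendRel X Y U).mkQ (coendι X Y V W φ x y)) =
      g ((coendRel X Y U).mkQ (coendι X Y V W φ x y))) : f = g :=
  Submodule.linearMap_qext _ (coendSum_hom_ext h)

/-- Postcomposition with `ψ` on every summand. -/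
def coendSumMap (X Y : SPF k d) {U U' : DivCat k d} (ψ : U ⟶ U') :
    CoendSum X Y U →ₗ[k] CoendSum X Y U' :=
  DirectSum.lmap fun p =>
    LinearMap.rTensor (X.val p.1 ⊗[k] Y.val p.2) (Linear.rightComp k (p.1.tensor p.2) ψ)

lemma coendSumMap_ι (X Y : SPF k d) {U U' : DivCat k d} (ψ : U ⟶ U') (V W : DivCat k d)
    (φ : V.tensor W ⟶ U) (x : X.val V) (y : Y.val W) :
    coendSumMap X Y ψ (coendι X Y V W φ x y) = coendι X Y V W (φ ≫ ψ) x y := by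
  classical
  simp [coendSumMap, coendι, DirectSum.lmap_lof]

/-- The action of `ψ` on the coend. -/
def coendMap (X Y : SPF k d) {U U' : DivCat k d} (ψ : U ⟶ U') :
    Coend X Y U →ₗ[k] Coend X Y U' :=
  Submodule.mapQ _ _ (coendSumMap X Y ψ) <| Submodule.span_le.2 <| by
    rintro _ ⟨V, V', W, W', g, h, φ, x, y, rfl⟩
    refine Submodule.subset_span ⟨V, V', W, W', g, h, φ ≫ ψ, x, y, ?_⟩
    rw [map_sub, coendSumMap_ι, coendSumMap_ι, Category.assoc]

lemma coendMap_ι (X Y : SPF k d) {U U' : DivCat k d} (ψ : U ⟶ U') (V W : DivCat k d)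
    (φ : V.tensor W ⟶ U) (x : X.val V) (y : Y.val W) :
    coendMap X Y ψ ((coendRel X Y U).mkQ (coendι X Y V W φ x y)) =
      (coendRel X Y U').mkQ (coendι X Y V W (φ ≫ ψ) x y) := by
  rw [← coendSumMap_ι]
  rfl

/-- The coend is already generated by the summands of the free modules `k^m`, `k^n`, so it is not
larger than a `k`-module in `Rep Γ^d_k`. -/
instance (X Y : SPF k d) (U : DivCat k d) : Small.{u} (Coend X Y U) := by
  classical
  let F : ℕ → DivCat k d := DivCat.free k d
  let T : ℕ × ℕ → Type u := fun q =>
    ((F q.1).tensor (F q.2) ⟶ U) ⊗[k] (X.val (F q.1) ⊗[k] Y.val (F q.2))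
  let j : DirectSum (ℕ × ℕ) T →ₗ[k] CoendSum X Y U :=
    DirectSum.toModule k _ _ fun q => DirectSum.lof k (DivCat k d × DivCat k d)
      (fun p => (p.1.tensor p.2 ⟶ U) ⊗[k] (X.val p.1 ⊗[k] Y.val p.2)) (F q.1, F q.2)
  have hj : ∀ m n φ x y, j (DirectSum.lof k _ T (m, n) (φ ⊗ₜ (x ⊗ₜ y))) =
      coendι X Y (F m) (F n) φ x y := fun m n φ x y => by
    refine (DirectSum.toModule_lof k (m, n) _).trans ?_
    simp only [coendι]
  let π : DirectSum (ℕ × ℕ) T →ₗ[k] Coend X Y U := (coendRel X Y U).mkQ ∘ₗ j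
  suffices h : LinearMap.range π = ⊤ from small_of_surjective (LinearMap.range_eq_top.1 h)
  have h0 : (LinearMap.range π).mkQ = 0 := by
    refine coend_hom_ext fun V W φ x y => ?_
    obtain ⟨m, i, p, hip⟩ := V.exists_retract
    obtain ⟨n, i', p', hip'⟩ := W.exists_retract
    have key : (coendRel X Y U).mkQ (coendι X Y V W φ x y) =
        π (DirectSum.lof k _ T (m, n)
          ((DivCat.tensorHom p p' ≫ φ) ⊗ₜ (X.act i x ⊗ₜ Y.act i' y))) := by
      change _ = (coendRel X Y U).mkQ (j _)
      rw [hj, eq_comm, ← sub_eq_zero, ← map_sub, Submodule.mkQ_apply,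
        Submodule.Quotient.mk_eq_zero]
      refine Submodule.subset_span ⟨_, _, _, _, p, p', φ, X.act i x, Y.act i' y, ?_⟩
      rw [← act_comp, ← act_comp, hip, hip', act_id, act_id]
    rw [key, LinearMap.zero_apply, Submodule.mkQ_apply, Submodule.Quotient.mk_eq_zero]
    exact LinearMap.mem_range_self _ _
  rw [← Submodule.ker_mkQ (LinearMap.range π), h0, LinearMap.ker_zero]

/-- A copy of the coend in the universe of `k`. -/
def CoendSmall (X Y : SPF k d) (U : DivCat k d) : Type u := Shrink.{u} (Coend X Y U)

instance (X Y : SPF k d) (U : DivCat k d) : AddCommGroup (CoendSmall X Y U) :=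
  inferInstanceAs (AddCommGroup (Shrink.{u} (Coend X Y U)))

instance (X Y : SPF k d) (U : DivCat k d) : Module k (CoendSmall X Y U) where
  __ := (inferInstance : Module k (Shrink.{u} (Coend X Y U)))

/-- The copy is linearly equivalent to the coend. -/
def coendEquiv (X Y : SPF k d) (U : DivCat k d) : CoendSmall X Y U ≃ₗ[k] Coend X Y U where
  __ := Shrink.linearEquiv.{u} k (Coend X Y U)

/-- The internal tensor product `X ⊗ Y` (Day convolution along the tensor product of `Γ^d P_k`):
the strict polynomial functor `U ↦ ∫^{V, W} Hom(V ⊗ W, U) ⊗ X(V) ⊗ Y(W)`. Since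
`Hom(V ⊗ W, -)` is the functor represented by `V ⊗ W`, this is the bifunctor that preserves colimits
in each variable and takes the functors represented by `V` and `W` to the one represented
by `V ⊗ W`. -/
def internalTensor (X Y : SPF k d) : SPF k d :=
  SPF.of (CoendSmall X Y)
    (fun {U U'} =>
      { toFun := fun ψ => (coendEquiv X Y U').symm.toLinearMap ∘ₗ
          coendMap X Y ψ ∘ₗ (coendEquiv X Y U).toLinearMap
        map_add' := fun ψ ψ' => by
          have : coendMap X Y (ψ + ψ') = coendMap X Y ψ + coendMap X Y ψ' :=
            coend_hom_ext fun V W φ x y => by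
              rw [LinearMap.add_apply, coendMap_ι, coendMap_ι, coendMap_ι, ← map_add]
              simp [coendι, TensorProduct.add_tmul]
          rw [this, LinearMap.add_comp, LinearMap.comp_add]
        map_smul' := fun r ψ => by
          have : coendMap X Y (r • ψ) = r • coendMap X Y ψ :=
            coend_hom_ext fun V W φ x y => by
              rw [LinearMap.smul_apply, coendMap_ι, coendMap_ι, ← map_smul, Linear.comp_smul,
                coendι, ← TensorProduct.smul_tmul', map_smul]
              rfl
          rw [this, LinearMap.smul_comp, LinearMap.comp_smul, RingHom.id_apply] })
    (fun U z => by
      have : coendMap X Y (𝟙 U) = LinearMap.id := coend_hom_ext fun V W φ x y => by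
        rw [coendMap_ι, Category.comp_id]
        rfl
      simp [this])
    (fun {U U' U''} ψ ψ' z => by
      have : coendMap X Y (ψ ≫ ψ') = coendMap X Y ψ' ∘ₗ coendMap X Y ψ :=
        coend_hom_ext fun V W φ x y => by
          rw [LinearMap.comp_apply, coendMap_ι, coendMap_ι, coendMap_ι, Category.assoc]
      simp [this])

end SPF

/-! ## Weights and Young subgroups -/

/-- `Λ(n, d)`: the sequences of `n` non-negative integers with sum `d`. -/
abbrev Weight (n d : ℕ) := {l : Fin n → ℕ // ∑ i, l i = d}

namespace Weight

variable {n m : ℕ}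

/-- The block that contains a place, where the `d` places are cut into consecutive blocks of
lengths `l 0, l 1, …`. -/
def block (l : Weight n d) (j : Fin d) : Fin n :=
  (finSigmaFinEquiv.symm (Fin.cast l.2.symm j)).1

/-- The Young subgroup `S_l` of the permutations that preserve every block. -/
def young (l : Weight n d) : Subgroup (Equiv.Perm (Fin d)) where
  carrier := {σ | ∀ j, l.block (σ j) = l.block j}
  mul_mem' {σ τ} hσ hτ j := by rw [Equiv.Perm.mul_apply, hσ, hτ]
  one_mem' _ := rfl
  inv_mem' {σ} hσ j := by
    rw [← hσ (σ⁻¹ j)]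
    simp

/-- The set `S` of the `n × m` matrices with non-negative integer entries, row sums `r` and column
sums `c`. -/
abbrev Matrices (r : Weight n d) (c : Weight m d) :=
  {A : Matrix (Fin n) (Fin m) ℕ // (∀ i, ∑ j, A i j = r.1 i) ∧ ∀ j, ∑ i, A i j = c.1 j}

/-- The weight in `Λ(n m, d)` that lists the entries of a matrix row by row. -/
def ofMatrix {r : Weight n d} {c : Weight m d} (A : Matrices r c) : Weight (n * m) d :=
  ⟨fun p => A.1 (finProdFinEquiv.symm p).1 (finProdFinEquiv.symm p).2, by
    rw [Equiv.sum_comp finProdFinEquiv.symm (fun q : Fin n × Fin m => A.1 q.1 q.2),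
      Fintype.sum_prod_type]
    simp only [A.2.1, r.2]⟩

end Weight

/-! ## The exponential functors

Cutting the places into blocks identifies `V^{⊗ d}` with `V^{⊗ l 0} ⊗ V^{⊗ l 1} ⊗ ⋯`. For `V`
finitely generated projective this identifies the tensor products of divided, symmetric and
exterior powers with a submodule and two quotients of `V^{⊗ d}`. The action of
`Γ^d(Hom(V, W))` is induced by its action on `V^{⊗ d}`. -/

variable {n : ℕ}

/-- `Γ^l = Γ^{l 0} ⊗ Γ^{l 1} ⊗ ⋯`, with value `(V^{⊗ d})^{S_l}` at `V`. -/
def Gam (k : Type u) [CommRing k] (l : Weight n d) : SPF k d :=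
  SPF.of (fun V => invariants k l.young V.carrier)
    (fun {V W} =>
      { toFun := fun f => (actT (DivCat.val f)).restrict fun t ht σ hσ => by
          rw [perm_actT (DivCat.val_mem f), ht σ hσ]
        map_add' := fun f g => LinearMap.ext fun t => Subtype.ext <|
          LinearMap.congr_fun ((actT.map_add _ _ : actT (DivCat.val (f + g)) = _)) t.1
        map_smul' := fun r f => LinearMap.ext fun t => Subtype.ext <|
          LinearMap.congr_fun ((actT.map_smul _ _ : actT (DivCat.val (r • f)) = _)) t.1 })
    (fun V t => Subtype.ext (actT_idT t.1))
    (fun f g t => Subtype.ext (actT_compT _ _ t.1))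

/-- The kernel of `V^{⊗ d} → Sym^{l 0}(V) ⊗ Sym^{l 1}(V) ⊗ ⋯`: the differences of a tensor and its
permutation inside the blocks. -/
def symRel (k : Type u) [CommRing k] (l : Weight n d) (M : Type u) [AddCommGroup M] [Module k M] :
    Submodule k (TPow k d M) :=
  Submodule.span k {t | ∃ σ ∈ l.young, ∃ s : TPow k d M, t = perm k σ s - s}

lemma symRel_le (l : Weight n d) {V W : DivCat k d} (f : V ⟶ W) :
    symRel k l V.carrier ≤ (symRel k l W.carrier).comap (actT (DivCat.val f)) := by
  refine Submodule.span_le.2 ?_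
  rintro _ ⟨σ, hσ, s, rfl⟩
  refine Submodule.subset_span ⟨σ, hσ, actT (DivCat.val f) s, ?_⟩
  rw [map_sub, perm_actT (DivCat.val_mem f)]

/-- `Sym^l = Sym^{l 0} ⊗ Sym^{l 1} ⊗ ⋯`, with value the coinvariants `(V^{⊗ d})_{S_l}` at `V`. -/
def Symm (k : Type u) [CommRing k] (l : Weight n d) : SPF k d :=
  SPF.of (fun V => TPow k d V.carrier ⧸ symRel k l V.carrier)
    (fun {V W} =>
      { toFun := fun f => Submodule.mapQ _ _ (actT (DivCat.val f)) (symRel_le l f)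
        map_add' := fun f g => by
          refine Submodule.linearMap_qext _ (LinearMap.ext fun t => ?_)
          simp
        map_smul' := fun r f => by
          refine Submodule.linearMap_qext _ (LinearMap.ext fun t => ?_)
          simp })
    (fun V t => by
      obtain ⟨t, rfl⟩ := Submodule.mkQ_surjective _ t
      simp [actT_idT])
    (fun f g t => by
      obtain ⟨t, rfl⟩ := Submodule.mkQ_surjective _ t
      simp [actT_compT])

/-- The kernel of `V^{⊗ d} → ∧^{l 0}(V) ⊗ ∧^{l 1}(V) ⊗ ⋯`: it is spanned by the pure tensors with
equal factors in two places of one block. -/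
def altRel (k : Type u) [CommRing k] (l : Weight n d) (M : Type u) [AddCommGroup M] [Module k M] :
    Submodule k (TPow k d M) :=
  Submodule.span k {t | ∃ (i j : Fin d) (x : Fin d → M), i ≠ j ∧ l.block i = l.block j ∧
    x i = x j ∧ t = PiTensorProduct.tprod k x}

section Alt

variable {M N : Type u} [AddCommGroup M] [Module k M] [AddCommGroup N] [Module k N]

/-- The span of the pure tensors with equal factors in the places `i` and `j`. -/
def altPair (k : Type u) [CommRing k] {d : ℕ} (i j : Fin d) (M : Type u) [AddCommGroup M]
    [Module k M] : Submodule k (TPow k d M) :=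
  Submodule.span k {t | ∃ x : Fin d → M, x i = x j ∧ t = PiTensorProduct.tprod k x}

lemma altPair_add_swap {i j : Fin d} (hij : i ≠ j) (x : Fin d → M) :
    PiTensorProduct.tprod k x + PiTensorProduct.tprod k (x ∘ Equiv.swap i j) ∈
      altPair k i j M := by
  have hx : ∀ a b : M, Function.update (Function.update x i a) j b i = a := fun a b => by
    rw [Function.update_of_ne hij, Function.update_self]
  have hy : ∀ a b : M, Function.update (Function.update x i a) j b j = b := fun a b => by
    rw [Function.update_self]
  let B : M → M → TPow k d M := fun a b =>
    PiTensorProduct.tprod k (Function.update (Function.update x i a) j b)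
  have hB : ∀ a, B a a ∈ altPair k i j M := fun a =>
    Submodule.subset_span ⟨_, by rw [hx, hy], rfl⟩
  have h₁ : ∀ a b b', B a (b + b') = B a b + B a b' := fun a b b' =>
    MultilinearMap.map_update_add _ _ _ _ _
  have h₂ : ∀ a a' b, B (a + a') b = B a b + B a' b := fun a a' b => by
    simp only [B, Function.update_comm hij]
    exact MultilinearMap.map_update_add _ _ _ _ _
  have e₁ : PiTensorProduct.tprod k x = B (x i) (x j) := by simp [B]
  have e₂ : PiTensorProduct.tprod k (x ∘ Equiv.swap i j) = B (x j) (x i) := by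
    simp only [B]
    congr 1
    ext p
    rcases eq_or_ne p i with rfl | hi
    · simp [hx]
    · rcases eq_or_ne p j with rfl | hj
      · simp
      · simp [hi, hj, Equiv.swap_apply_of_ne_of_ne]
  have e : PiTensorProduct.tprod k x + PiTensorProduct.tprod k (x ∘ Equiv.swap i j) =
      B (x i + x j) (x i + x j) - B (x i) (x i) - B (x j) (x j) := by
    rw [e₁, e₂, h₁, h₂, h₂]
    abel
  rw [e]
  exact sub_mem (sub_mem (hB _) (hB _)) (hB _)

lemma mem_altPair_of_free {m : ℕ} {i j : Fin d} (hij : i ≠ j) {t : TPow k d (Fin m → k)}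
    (ht : perm k (Equiv.swap i j) t = t) : t ∈ altPair k i j (Fin m → k) := by
  classical
  let e : Fin m → Fin m → k := Pi.basisFun k (Fin m)
  let b : Module.Basis (Fin d → Fin m) k (TPow k d (Fin m → k)) :=
    Basis.piTensorProduct (fun _ => Pi.basisFun k (Fin m))
  have hb : ∀ w, b w = PiTensorProduct.tprod k (fun p => e (w p)) := fun w =>
    Basis.piTensorProduct_apply _ _
  have hperm : ∀ w, perm k (Equiv.swap i j) (b w) = b (w ∘ Equiv.swap i j) := fun w => by
    rw [hb, hb, perm_tprod]
    rfl
  have hinv : ∀ w : Fin d → Fin m, (w ∘ Equiv.swap i j) ∘ Equiv.swap i j = w := fun w => by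
    ext p
    simp
  have hc : ∀ w, b.repr t (w ∘ Equiv.swap i j) = b.repr t w := by
    have h : (b.repr.toLinearMap ∘ₗ perm k (Equiv.swap i j)) =
        (Finsupp.lmapDomain k k (fun w : Fin d → Fin m => w ∘ Equiv.swap i j)) ∘ₗ
          b.repr.toLinearMap := by
      refine b.ext fun w => ?_
      simp [hperm]
    intro w
    have h' := LinearMap.congr_fun h t
    simp only [LinearMap.comp_apply, ht, LinearEquiv.coe_coe, Finsupp.lmapDomain_apply] at h'
    have hinj : Function.Injective (fun w : Fin d → Fin m => w ∘ Equiv.swap i j) :=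
      Function.LeftInverse.injective (g := fun w => w ∘ Equiv.swap i j) hinv
    conv_lhs => rw [h']
    exact Finsupp.mapDomain_apply hinj _ _
  rw [← Submodule.Quotient.mk_eq_zero, ← Submodule.mkQ_apply, ← b.sum_repr t, map_sum]
  refine Finset.sum_involution (fun w _ => w ∘ Equiv.swap i j) ?_ ?_ (fun _ _ => Finset.mem_univ _)
    (fun w _ => hinv w)
  · intro w _
    rw [hc, ← map_add, ← smul_add, map_smul, hb, hb]
    have : (altPair k i j (Fin m → k)).mkQ (PiTensorProduct.tprod k (fun p => e (w p)) +
        PiTensorProduct.tprod k (fun p => e ((w ∘ Equiv.swap i j) p))) = 0 := by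
      rw [Submodule.mkQ_apply, Submodule.Quotient.mk_eq_zero]
      exact altPair_add_swap hij (fun p => e (w p))
    rw [this, smul_zero]
  · intro w _ hw heq
    apply hw
    rw [map_smul, hb]
    have : (altPair k i j (Fin m → k)).mkQ (PiTensorProduct.tprod k (fun p => e (w p))) = 0 := by
      rw [Submodule.mkQ_apply, Submodule.Quotient.mk_eq_zero]
      refine Submodule.subset_span ⟨_, ?_, rfl⟩
      have := congrFun heq j
      simp only [Function.comp_apply, Equiv.swap_apply_right] at this
      rw [this]
    rw [this, smul_zero]

/-- Over a finitely generated projective module, a tensor that is fixed by the exchange of two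
places is a combination of pure tensors with equal factors in these places. -/
lemma mem_altPair [Module.Finite k M] [Module.Projective k M] {i j : Fin d} (hij : i ≠ j)
    {t : TPow k d M} (ht : perm k (Equiv.swap i j) t = t) : t ∈ altPair k i j M := by
  obtain ⟨m, p, s, -, -, hps⟩ := Module.Finite.exists_comp_eq_id_of_projective k M
  have h := mem_altPair_of_free (k := k) hij
    (t := actT (PiTensorProduct.tprod k (fun _ : Fin d => s)) t)
    (by rw [perm_actT (diag_mem s), ht])
  have hle : altPair k i j (Fin m → k) ≤
      (altPair k i j M).comap (actT (PiTensorProduct.tprod k (fun _ : Fin d => p))) := by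
    refine Submodule.span_le.2 ?_
    rintro _ ⟨x, hx, rfl⟩
    refine Submodule.subset_span ⟨fun q => p (x q), congrArg p hx, ?_⟩
    rw [actT_tprod]
  have h' := hle h
  rw [Submodule.mem_comap, ← actT_compT, compT_tprod, hps] at h'
  have := actT_idT t
  rw [idT] at this
  rwa [this] at h'

lemma altRel_le (l : Weight n d) {V W : DivCat k d} (f : V ⟶ W) :
    altRel k l V.carrier ≤ (altRel k l W.carrier).comap (actT (DivCat.val f)) := by
  refine Submodule.span_le.2 ?_
  rintro _ ⟨i, j, x, hij, hb, hx, rfl⟩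
  have hfix : perm k (Equiv.swap i j) (PiTensorProduct.tprod k x) = PiTensorProduct.tprod k x := by
    rw [perm_tprod]
    congr 1
    ext p
    rcases eq_or_ne p i with rfl | hi
    · simp [hx]
    · rcases eq_or_ne p j with rfl | hj
      · simp [hx]
      · simp [Equiv.swap_apply_of_ne_of_ne, hi, hj]
  have h := mem_altPair hij (t := actT (DivCat.val f) (PiTensorProduct.tprod k x))
    (by rw [perm_actT (DivCat.val_mem f), hfix])
  have hle : altPair k i j W.carrier ≤ altRel k l W.carrier := by
    refine Submodule.span_le.2 ?_
    rintro _ ⟨y, hy, rfl⟩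
    exact Submodule.subset_span ⟨i, j, y, hij, hb, hy, rfl⟩
  exact hle h

end Alt

/-- `∧^l = ∧^{l 0} ⊗ ∧^{l 1} ⊗ ⋯`, as a quotient of `V^{⊗ d}` at `V`. -/
def Wedge (k : Type u) [CommRing k] (l : Weight n d) : SPF k d :=
  SPF.of (fun V => TPow k d V.carrier ⧸ altRel k l V.carrier)
    (fun {V W} =>
      { toFun := fun f => Submodule.mapQ _ _ (actT (DivCat.val f)) (altRel_le l f)
        map_add' := fun f g => by
          refine Submodule.linearMap_qext _ (LinearMap.ext fun t => ?_)
          simp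
        map_smul' := fun r f => by
          refine Submodule.linearMap_qext _ (LinearMap.ext fun t => ?_)
          simp })
    (fun V t => by
      obtain ⟨t, rfl⟩ := Submodule.mkQ_surjective _ t
      simp [actT_idT])
    (fun f g t => by
      obtain ⟨t, rfl⟩ := Submodule.mkQ_surjective _ t
      simp [actT_compT])

/-! ## Permutation modules -/

/-- The permutation module `M^l = k[S_d / S_l]` of the symmetric group. -/
abbrev permModule (k : Type u) [CommRing k] (l : Weight n d) :
    Representation k (Equiv.Perm (Fin d)) (MonoidAlgebra k (Equiv.Perm (Fin d) ⧸ l.young)) :=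
  Representation.ofMulAction k (Equiv.Perm (Fin d)) (Equiv.Perm (Fin d) ⧸ l.young)

end
end StrictPoly

/-! Write T for the functor V ↦ V^{⊗ d}. Evaluation at the standard tensor e₁ ⊗ ⋯ ⊗ e_d makes T a
direct summand of the functor represented by k^d (`actT_extT`). If Y is a quotient of copies of T,
every class in the coend for X and Y therefore comes from W = k^d, and the multiplication of k^d
then also moves the argument of X into X(k^d).

Words of weight λ, that is, cosets of S_λ in S_d, index everything. With Ω' the words of weight μ,
Sym^μ is the quotient of k[Ω'] ⊗ T by σw ⊗ σt ∼ w ⊗ t. For ∧^μ the relation carries the sign of σ,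
and moreover w ⊗ t is killed when t has equal factors in two places whose exchange fixes w. The
first factor X enters through coefficients c_w : X(V) → V^{⊗ d}, one for each word w in Ω,
equivariant up to a character ε. For Γ^λ they are permutations of the invariant tensor, for Sym^λ
and ∧^λ they are plain or signed sums over S_d. By `Coefficients.nonempty_iso`, the internal tensor
product is the quotient of k[Ω × Ω'] ⊗ T by what the families c_w(x) ⊗ y_{w'} generate when y runs
through the relations of Y.

It remains to compute these relations. The characters multiply (`pair_mem_charRel`,
`charRel_le_pairSpan`), so two signs cancel and ∧ with ∧ gives Sym. The diagonal relations of ∧^μ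
make the difference between Γ and Sym. Invariant tensors include orbit sums in which each word
occurs once, so Γ^λ transmits the diagonal relations (`diagRel_le_pairSpan`). Coefficients that are
sums over all of S_d make them cancel in pairs (`ofPresentation_pair_mem_charRel`). Hence Sym with ∧
is presented by the sign relation alone, which is the presentation of ∧ if 2 is a unit and of Sym if
2 = 0.

Finally, a pair of words is one word in the letters (i, j), and the multiplicities of its letters
form a matrix in S. This bijection of S_d-sets (`splitEquiv`) splits the relations into those of the
summands (`mem_charRel_iff`, `mem_extRel_iff`), and on bases it is the decomposition of the
permutation modules. -/

namespace StrictPoly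

noncomputable section

/-! ## Symmetrization of tensors -/

section Symmetrize

variable {k : Type u} [CommRing k] {d : ℕ}
variable {M N P Q : Type u} [AddCommGroup M] [Module k M] [AddCommGroup N] [Module k N]
  [AddCommGroup P] [Module k P] [AddCommGroup Q] [Module k Q]

lemma tpow_hom_ext {f g : TPow k d M →ₗ[k] N}
    (h : ∀ x : Fin d → M, f (PiTensorProduct.tprod k x) = g (PiTensorProduct.tprod k x)) :
    f = g :=
  PiTensorProduct.ext (MultilinearMap.ext h)

lemma perm_one (t : TPow k d M) : perm k 1 t = t := by
  induction t using tpow_induction with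
  | h x => simp only [perm_tprod]; rfl
  | hs c t h => simp [h]
  | ha s t h₁ h₂ => simp [h₁, h₂]

lemma perm_mul (σ τ : Equiv.Perm (Fin d)) (t : TPow k d M) :
    perm k (σ * τ) t = perm k σ (perm k τ t) := by
  induction t using tpow_induction with
  | h x => simp only [perm_tprod]; rfl
  | hs c t h => simp [h]
  | ha s t h₁ h₂ => simp [h₁, h₂]

lemma perm_inv_perm (σ : Equiv.Perm (Fin d)) (t : TPow k d M) :
    perm k σ⁻¹ (perm k σ t) = t := by
  rw [← perm_mul, inv_mul_cancel, perm_one]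

/-- The sum of all permutations of a tensor. -/
def symmetrize (k : Type u) [CommRing k] (d : ℕ) (M : Type u) [AddCommGroup M] [Module k M] :
    TPow k d M →ₗ[k] TPow k d M :=
  ∑ σ : Equiv.Perm (Fin d), perm k σ

lemma symmetrize_apply (t : TPow k d M) :
    symmetrize k d M t = ∑ σ : Equiv.Perm (Fin d), perm k σ t := by
  simp [symmetrize]

lemma symmetrize_mem (t : TPow k d M) : symmetrize k d M t ∈ DPow k d M := fun σ _ => by
  rw [symmetrize_apply, map_sum]
  simp only [← perm_mul]
  exact Fintype.sum_equiv (Equiv.mulLeft σ) _ _ fun _ => rfl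

/-- A projection formula: the invariant factor absorbs each permutation, so only one of two
symmetrized factors needs to be expanded. -/
lemma place₂_symmetrize_left (b : M →ₗ[k] N →ₗ[k] P) (s : TPow k d M) {t : TPow k d N}
    (ht : t ∈ DPow k d N) :
    place₂ d b (symmetrize k d M s) t = symmetrize k d P (place₂ d b s t) := by
  simp only [symmetrize_apply, map_sum, LinearMap.sum_apply, perm_place₂]
  exact Finset.sum_congr rfl fun σ _ => by rw [ht σ trivial]

lemma place₂_symmetrize_right (b : M →ₗ[k] N →ₗ[k] P) {s : TPow k d M} (t : TPow k d N)
    (hs : s ∈ DPow k d M) :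
    place₂ d b s (symmetrize k d N t) = symmetrize k d P (place₂ d b s t) := by
  simp only [symmetrize_apply, map_sum, perm_place₂]
  exact Finset.sum_congr rfl fun σ _ => by rw [hs σ trivial]

lemma tprod_eq_zero {x : Fin d → M} (i : Fin d) (h : x i = 0) :
    PiTensorProduct.tprod k x = 0 :=
  (PiTensorProduct.tprod k).map_coord_zero i h

/-- A permutation other than the identity moves some place, and the factor there vanishes. This is
how sums over the symmetric group collapse to one term below. -/
lemma sum_tprod_perm (A : Fin d → Fin d → M) (hA : ∀ i j, i ≠ j → A i j = 0) :
    ∑ σ : Equiv.Perm (Fin d), PiTensorProduct.tprod k (fun i => A i (σ.symm i)) =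
      PiTensorProduct.tprod k (fun i => A i i) := by
  rw [Finset.sum_eq_single (1 : Equiv.Perm (Fin d))]
  · rfl
  · intro σ _ hσ
    obtain ⟨i, hi⟩ : ∃ i, i ≠ σ.symm i := by
      by_contra! h
      exact hσ (Equiv.ext fun i => by simpa using congrArg σ (h i))
    exact tprod_eq_zero i (hA _ _ hi)
  · simp

/-! ## The standard tensor -/

/-- The tensor `e₁ ⊗ ⋯ ⊗ e_d` of the standard basis of `k^d`. -/
def stdT (k : Type u) [CommRing k] (d : ℕ) : TPow k d (Fin d → k) :=
  PiTensorProduct.tprod k (fun i => Pi.single i (1 : k))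

/-- The tensor product of two tensors, place by place. -/
def tmulT : TPow k d M →ₗ[k] TPow k d N →ₗ[k] TPow k d (M ⊗[k] N) :=
  place₂ d (TensorProduct.mk k M N)

@[simp] lemma tmulT_tprod (x : Fin d → M) (y : Fin d → N) :
    tmulT (PiTensorProduct.tprod k x) (PiTensorProduct.tprod k y) =
      PiTensorProduct.tprod k (fun i => x i ⊗ₜ[k] y i) := place₂_tprod _ _ _

lemma perm_tmulT (σ : Equiv.Perm (Fin d)) (s : TPow k d M) (t : TPow k d N) :
    perm k σ (tmulT s t) = tmulT (perm k σ s) (perm k σ t) := perm_place₂ _ _ _ _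

lemma actT_tensT_tmulT (f : TPow k d (M →ₗ[k] N)) (g : TPow k d (P →ₗ[k] Q)) (s : TPow k d M)
    (t : TPow k d P) : actT (tensT f g) (tmulT s t) = tmulT (actT f s) (actT g t) := by
  induction f using tpow_induction with
  | h x =>
    induction g using tpow_induction with
    | h y =>
      induction s using tpow_induction with
      | h z =>
        induction t using tpow_induction with
        | h w => simp
        | hs c t h => simp only [map_smul, h]
        | ha s t h₁ h₂ => simp only [map_add, h₁, h₂]
      | hs c t h => simp only [map_smul, LinearMap.smul_apply, h]
      | ha s t h₁ h₂ => simp only [map_add, LinearMap.add_apply, h₁, h₂]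
    | hs c t h => simp only [map_smul, LinearMap.smul_apply, h]
    | ha s t h₁ h₂ => simp only [map_add, LinearMap.add_apply, h₁, h₂]
  | hs c t h => simp only [map_smul, LinearMap.smul_apply, h]
  | ha s t h₁ h₂ => simp only [map_add, LinearMap.add_apply, h₁, h₂]

/-- The tensor of the rank one maps `e_i ↦ x_i`, for a tensor `x₁ ⊗ ⋯ ⊗ x_d`. -/
def rankOneT : TPow k d M →ₗ[k] TPow k d ((Fin d → k) →ₗ[k] M) :=
  place₂ d (LinearMap.smulRightₗ (R := k) (M₂ := Fin d → k) (M := M))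
    (PiTensorProduct.tprod k (fun i => LinearMap.proj i))

@[simp] lemma rankOneT_tprod (x : Fin d → M) :
    rankOneT (PiTensorProduct.tprod k x) = PiTensorProduct.tprod k
      (fun i => (LinearMap.proj i : (Fin d → k) →ₗ[k] k).smulRight (x i)) :=
  place₂_tprod _ _ _

/-- The symmetric tensor of maps that takes the standard tensor to a given one. -/
def extT : TPow k d M →ₗ[k] TPow k d ((Fin d → k) →ₗ[k] M) := symmetrize k d _ ∘ₗ rankOneT

lemma extT_mem (t : TPow k d M) : extT t ∈ DPow k d ((Fin d → k) →ₗ[k] M) := symmetrize_mem _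

/-- The rank one maps labelled by a permutation do not kill the standard tensor only if the labels
match in every place. Hence `extT` is a section of evaluation at the standard tensor, and the tensor
power is a direct summand of a representable functor. -/
lemma actT_extT (t : TPow k d M) : actT (extT t) (stdT k d) = t := by
  have : ((actT.flip (stdT k d)) ∘ₗ extT : TPow k d M →ₗ[k] TPow k d M) = LinearMap.id := by
    refine tpow_hom_ext fun x => ?_
    simp only [LinearMap.comp_apply, extT, rankOneT_tprod, symmetrize_apply, LinearMap.flip_apply,
      map_sum, perm_tprod, stdT, actT_tprod, LinearMap.id_apply]
    rw [sum_tprod_perm (fun i j => ((LinearMap.proj j : (Fin d → k) →ₗ[k] k).smulRight (x j))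
      (Pi.single i 1))]
    · simp
    · intro i j hij
      simp [Pi.single_eq_of_ne hij.symm]
  exact LinearMap.congr_fun this t

lemma actT_extT_perm (t : TPow k d M) (σ : Equiv.Perm (Fin d)) :
    actT (extT t) (perm k σ (stdT k d)) = perm k σ t := by
  rw [← perm_actT (extT_mem t), actT_extT]

/-- Composition with rank one maps only moves their values, and the invariance of `f` lets it pass
through the symmetrization. -/
lemma compT_extT {f : TPow k d (M →ₗ[k] N)} (hf : f ∈ DPow k d (M →ₗ[k] N)) (t : TPow k d M) :
    compT f (extT t) = extT (actT f t) := by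
  have key : ∀ f : TPow k d (M →ₗ[k] N), compT f (rankOneT t) = rankOneT (actT f t) := by
    intro f
    induction f using tpow_induction with
    | h x =>
      induction t using tpow_induction with
      | h y =>
        simp only [rankOneT_tprod, compT_tprod, actT_tprod]
        congr 1
        ext i : 1
        refine LinearMap.ext fun v => ?_
        simp
      | hs c t h => simp only [map_smul, h]
      | ha s t h₁ h₂ => simp only [map_add, h₁, h₂]
    | hs c t h => simp only [map_smul, LinearMap.smul_apply, h]
    | ha s t h₁ h₂ => simp only [map_add, LinearMap.add_apply, h₁, h₂]
  simp only [extT, LinearMap.comp_apply]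
  rw [← key, compT, place₂_symmetrize_right _ _ hf]

/-- The multiplication of `k^d`, `e_i ⊗ e_j ↦ δ_ij e_i`. -/
def mulStd (k : Type u) [CommRing k] (d : ℕ) : (Fin d → k) ⊗[k] (Fin d → k) →ₗ[k] (Fin d → k) :=
  LinearMap.mul' k (Fin d → k)

/-- The basis vectors of k^d are orthogonal idempotents, so two rearrangements of the standard
tensor multiply to zero as soon as they differ in one place. -/
lemma actT_mulStd (σ τ : Equiv.Perm (Fin d)) :
    actT (PiTensorProduct.tprod k fun _ : Fin d => mulStd k d)
      (tmulT (perm k τ (stdT k d)) (perm k σ (stdT k d))) =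
      if τ = σ then perm k σ (stdT k d) else 0 := by
  simp only [stdT, perm_tprod, tmulT_tprod, actT_tprod, mulStd, LinearMap.mul'_apply]
  split_ifs with h
  · subst h
    congr 1
    ext i : 1
    rw [← Pi.single_mul, one_mul]
  · obtain ⟨i, hi⟩ : ∃ i, τ.symm i ≠ σ.symm i := by
      by_contra! h'
      exact h (Equiv.symm_bijective.injective (Equiv.ext h'))
    refine tprod_eq_zero i ?_
    ext j
    rcases eq_or_ne j (τ.symm i) with rfl | hj
    · simp [Pi.single_eq_of_ne hi]
    · simp [Pi.single_eq_of_ne hj]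

/-- The map `(V ⊗ k^d) ⊗ k^d → V ⊗ k^d` given by the multiplication of `k^d`. -/
def mulStdLeft (k : Type u) [CommRing k] (d : ℕ) (M : Type u) [AddCommGroup M] [Module k M] :
    (M ⊗[k] (Fin d → k)) ⊗[k] (Fin d → k) →ₗ[k] M ⊗[k] (Fin d → k) :=
  (mulStd k d).lTensor M ∘ₗ (TensorProduct.assoc k M (Fin d → k) (Fin d → k)).toLinearMap

@[simp] lemma mulStdLeft_tmul (v : M) (a b : Fin d → k) :
    mulStdLeft k d M ((v ⊗ₜ a) ⊗ₜ b) = v ⊗ₜ (a * b) := by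
  simp [mulStdLeft, mulStd]

/-- The symmetrization of the inclusions `v ↦ v ⊗ e_i` of `V` into `V ⊗ k^d`. -/
def inclT (k : Type u) [CommRing k] (d : ℕ) (M : Type u) [AddCommGroup M] [Module k M] :
    TPow k d (M →ₗ[k] M ⊗[k] (Fin d → k)) :=
  symmetrize k d _ (PiTensorProduct.tprod k fun i =>
    (TensorProduct.mk k M (Fin d → k)).flip (Pi.single i 1))

lemma inclT_mem : inclT k d M ∈ DPow k d (M →ₗ[k] M ⊗[k] (Fin d → k)) := symmetrize_mem _

lemma actT_inclT (t : TPow k d M) :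
    actT (inclT k d M) t = ∑ σ : Equiv.Perm (Fin d), tmulT t (perm k σ (stdT k d)) := by
  have : (actT (inclT k d M) : TPow k d M →ₗ[k] _) =
      ∑ σ : Equiv.Perm (Fin d), tmulT.flip (perm k σ (stdT k d)) := by
    refine tpow_hom_ext fun x => ?_
    simp [inclT, symmetrize_apply, stdT]
  rw [this]
  simp

/-- The label e_i attached by the inclusion is multiplied with the label e_j produced by `extT`, and
e_i e_j = 0 unless i = j. So attaching labels and then multiplying has the same effect as not
attaching them. This is what allows an element of X(V) to be replaced by its image in X(V ⊗ k^d). -/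
lemma compT_mulStdLeft_inclT :
    compT (PiTensorProduct.tprod k fun _ : Fin d => mulStdLeft k d M)
      (tensT (inclT k d M) (extT (stdT k d))) = tensT (idT k d M) (extT (stdT k d)) := by
  -- Both sides become one outer symmetrization, which is stripped off. The remaining inner sum over
  -- permutations then has only its identity term.
  have h₁ : tensT (inclT k d M) (extT (stdT k d)) = symmetrize k d _ (tensT
      (PiTensorProduct.tprod k fun i => (TensorProduct.mk k M (Fin d → k)).flip (Pi.single i 1))
      (extT (stdT k d))) := place₂_symmetrize_left _ _ (extT_mem _)
  have h₂ : tensT (idT k d M) (extT (stdT k d)) = symmetrize k d _ (tensT (idT k d M)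
      (rankOneT (stdT k d))) := place₂_symmetrize_right _ _ (diag_mem _)
  rw [h₁, h₂, compT, place₂_symmetrize_right _ _ (diag_mem _), ← compT]
  congr 1
  simp only [extT, stdT, LinearMap.comp_apply, rankOneT_tprod, symmetrize_apply, map_sum,
    perm_tprod, tensT_tprod, compT_tprod, idT]
  rw [sum_tprod_perm (fun i j => mulStdLeft k d M ∘ₗ TensorProduct.map
    ((TensorProduct.mk k M (Fin d → k)).flip (Pi.single i 1))
      ((LinearMap.proj j : (Fin d → k) →ₗ[k] k).smulRight (Pi.single j (1 : k))))]
  · congr 1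
    ext i : 1
    refine TensorProduct.ext' fun v a => ?_
    simp [← Pi.single_mul]
  · intro i j hij
    refine TensorProduct.ext' fun v a => ?_
    have : (Pi.single i (1 : k) * Pi.single j (1 : k) : Fin d → k) = 0 := by
      ext l
      rcases eq_or_ne l i with rfl | hl
      · simp [Pi.single_eq_of_ne hij]
      · simp [Pi.single_eq_of_ne hl]
    simp [this]

/-- Each factor of `t` carries its own label e_i in the second component. Matching this label with
another one after the extension is the same as matching the two labels in k^d before it. -/
lemma compT_mulStdLeft_extT (t : TPow k d M) :
    compT (PiTensorProduct.tprod k fun _ : Fin d => mulStdLeft k d M)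
      (tensT (extT (tmulT t (stdT k d))) (extT (stdT k d))) =
    compT (extT (tmulT t (stdT k d))) (PiTensorProduct.tprod k fun _ : Fin d => mulStd k d) := by
  have h₁ : tensT (extT (tmulT t (stdT k d))) (extT (stdT k d)) = symmetrize k d _ (tensT
      (rankOneT (tmulT t (stdT k d))) (extT (stdT k d))) :=
    place₂_symmetrize_left _ _ (extT_mem _)
  have h₂ : compT (extT (tmulT t (stdT k d))) (PiTensorProduct.tprod k fun _ => mulStd k d) =
      symmetrize k d _ (compT (rankOneT (tmulT t (stdT k d)))
        (PiTensorProduct.tprod k fun _ => mulStd k d)) :=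
    place₂_symmetrize_left _ _ (diag_mem _)
  rw [h₁, h₂, compT, place₂_symmetrize_right _ _ (diag_mem _), ← compT]
  congr 1
  clear h₁ h₂
  induction t using tpow_induction with
  | h x =>
    simp only [extT, stdT, LinearMap.comp_apply, rankOneT_tprod, symmetrize_apply, map_sum,
      perm_tprod, tensT_tprod, compT_tprod, tmulT_tprod]
    rw [sum_tprod_perm (fun i j => mulStdLeft k d M ∘ₗ TensorProduct.map
      ((LinearMap.proj i : (Fin d → k) →ₗ[k] k).smulRight (x i ⊗ₜ[k] Pi.single i (1 : k)))
        ((LinearMap.proj j : (Fin d → k) →ₗ[k] k).smulRight (Pi.single j (1 : k))))]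
    · congr 1
      ext i : 1
      refine TensorProduct.ext' fun v a => ?_
      simp only [LinearMap.comp_apply, TensorProduct.map_tmul, LinearMap.smulRight_apply,
        LinearMap.proj_apply, mulStd, LinearMap.mul'_apply, Pi.mul_apply]
      rw [← TensorProduct.smul_tmul', TensorProduct.tmul_smul, map_smul, map_smul,
        mulStdLeft_tmul, ← Pi.single_mul, one_mul, smul_smul]
    · intro i j hij
      refine TensorProduct.ext' fun v a => ?_
      have : (Pi.single i (1 : k) * Pi.single j (1 : k) : Fin d → k) = 0 := by
        ext l
        rcases eq_or_ne l i with rfl | hl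
        · simp [Pi.single_eq_of_ne hij]
        · simp [Pi.single_eq_of_ne hl]
      simp [← TensorProduct.smul_tmul', this]
  | hs c t h => simp only [map_smul, LinearMap.smul_apply, h]
  | ha s t h₁ h₂ => simp only [map_add, LinearMap.add_apply, h₁, h₂]

end Symmetrize

end

end StrictPoly

namespace StrictPoly

noncomputable section

variable {k : Type u} [CommRing k] {d : ℕ}

/-! ### Morphisms between V, k^d and their tensor products -/

namespace DivCat

/-- The morphism `k^d ⟶ V` that takes the standard tensor to `t`. -/
def extHom {V : DivCat k d} (t : TPow k d V.carrier) : free k d d ⟶ V := ⟨extT t, extT_mem t⟩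

/-- The morphism `V ⟶ V ⊗ k^d` that is the sum of all `v₁ ⊗ ⋯ ⊗ v_d ↦ (vᵢ ⊗ e_{σ i})ᵢ`. -/
def inclHom (V : DivCat k d) : V ⟶ V.tensor (free k d d) := ⟨inclT k d V.carrier, inclT_mem⟩

/-- The morphism `k^d ⊗ k^d ⟶ k^d` given by multiplication. -/
def mulHom (k : Type u) [CommRing k] (d : ℕ) : (free k d d).tensor (free k d d) ⟶ free k d d :=
  diag (V := (free k d d).tensor (free k d d)) (W := free k d d) (mulStd k d)

/-- The morphism `(V ⊗ k^d) ⊗ k^d ⟶ V ⊗ k^d` given by multiplication. -/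
def mulLeftHom (V : DivCat k d) :
    (V.tensor (free k d d)).tensor (free k d d) ⟶ V.tensor (free k d d) :=
  diag (V := (V.tensor (free k d d)).tensor (free k d d)) (W := V.tensor (free k d d))
    (mulStdLeft k d V.carrier)

/-- The morphism `extHom`, as a linear map. -/
def extHomₗ (V : DivCat k d) : TPow k d V.carrier →ₗ[k] (free k d d ⟶ V) where
  toFun := extHom
  map_add' s t := val_injective (map_add (extT (k := k) (d := d)) s t)
  map_smul' r t := val_injective (map_smul (extT (k := k) (d := d)) r t)

/-- The tensor power `V^{⊗ d}`. -/
abbrev T (V : DivCat k d) : Type u := TPow k d V.carrier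

/-- The action of a morphism of `Γ^d P_k` on tensor powers. -/
def tact {V W : DivCat k d} (f : V ⟶ W) : V.T →ₗ[k] W.T := actT (val f)

/-- The product `V^{⊗ d} × W^{⊗ d} → (V ⊗ W)^{⊗ d}`. -/
def tmul {V W : DivCat k d} : V.T →ₗ[k] W.T →ₗ[k] (V.tensor W).T := tmulT

/-- The standard tensor `e₁ ⊗ ⋯ ⊗ e_d` of `k^d`. -/
def std (k : Type u) [CommRing k] (d : ℕ) : (free k d d).T := stdT k d

lemma tact_id {V : DivCat k d} (t : V.T) : tact (𝟙 V) t = t := actT_idT t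

lemma tact_comp {U V W : DivCat k d} (f : U ⟶ V) (g : V ⟶ W) (t : U.T) :
    tact (f ≫ g) t = tact g (tact f t) := actT_compT _ _ t

lemma perm_tact {V W : DivCat k d} (f : V ⟶ W) (σ : Equiv.Perm (Fin d)) (t : V.T) :
    perm k σ (tact f t) = tact f (perm k σ t) := perm_actT (val_mem f) σ t

lemma perm_tmul {V W : DivCat k d} (σ : Equiv.Perm (Fin d)) (s : V.T) (t : W.T) :
    perm k σ (tmul s t) = tmul (perm k σ s) (perm k σ t) := perm_tmulT σ s t

lemma tact_tensorHom {V V' W W' : DivCat k d} (f : V ⟶ V') (g : W ⟶ W') (s : V.T) (t : W.T) :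
    tact (tensorHom f g) (tmul s t) = tmul (tact f s) (tact g t) := actT_tensT_tmulT _ _ s t

lemma tact_extHom {V : DivCat k d} (t : V.T) : tact (extHom t) (std k d) = t := actT_extT t

lemma tact_extHom_perm {V : DivCat k d} (t : V.T) (σ : Equiv.Perm (Fin d)) :
    tact (extHom t) (perm k σ (std k d)) = perm k σ t := actT_extT_perm t σ

lemma tact_inclHom {V : DivCat k d} (t : V.T) :
    tact V.inclHom t = ∑ σ : Equiv.Perm (Fin d), tmul t (perm k σ (std k d)) := actT_inclT t

lemma extHom_comp {V W : DivCat k d} (t : V.T) (φ : V ⟶ W) :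
    extHom t ≫ φ = extHom (tact φ t) :=
  val_injective (compT_extT (val_mem φ) t)

lemma inclHom_mulLeftHom (V : DivCat k d) :
    tensorHom V.inclHom (extHom (std k d)) ≫ V.mulLeftHom = tensorHom (𝟙 V) (extHom (std k d)) :=
  val_injective compT_mulStdLeft_inclT

lemma extHom_mulLeftHom {V : DivCat k d} (t : V.T) :
    tensorHom (extHom (tmul t (std k d))) (extHom (std k d)) ≫ V.mulLeftHom =
      mulHom k d ≫ extHom (tmul t (std k d)) :=
  val_injective (compT_mulStdLeft_extT t)

lemma tact_mulHom_extHom {V : DivCat k d} (t : V.T) (σ τ : Equiv.Perm (Fin d)) :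
    tact (mulHom k d ≫ extHom t) (tmul (perm k τ (std k d)) (perm k σ (std k d))) =
      if τ = σ then perm k σ t else 0 := by
  have h : tact (mulHom k d) (tmul (perm k τ (std k d)) (perm k σ (std k d))) =
      if τ = σ then perm k σ (std k d) else 0 := actT_mulStd σ τ
  rw [tact_comp, h]
  split_ifs
  · rw [tact_extHom_perm]
  · rw [map_zero]

end DivCat

namespace SPF

/-- A natural family of linear isomorphisms gives an isomorphism of strict polynomial functors. -/
def isoOfLinearEquiv {X Y : SPF k d} (e : ∀ V, X.val V ≃ₗ[k] Y.val V)
    (h : ∀ {V W : DivCat k d} (f : V ⟶ W) (x : X.val V), e W (X.act f x) = Y.act f (e V x)) :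
    X ≅ Y :=
  ObjectProperty.isoMk _ <| NatIso.ofComponents (fun V => (e V).toModuleIso) fun f => by
    ext x
    exact h f x

/-! ### Maps out of the internal tensor product -/

section Desc

variable (X Y Z : SPF k d)

/-- The class of `φ ⊗ x ⊗ y` in the coend. -/
def coendMk (V W : DivCat k d) {U : DivCat k d} :
    (V.tensor W ⟶ U) →ₗ[k] X.val V →ₗ[k] Y.val W →ₗ[k] Coend X Y U :=
  open scoped Classical in
  TensorProduct.lcurry (.id k) (X.val V) (Y.val W) (Coend X Y U) ∘ₗ
    TensorProduct.curry ((coendRel X Y U).mkQ ∘ₗ DirectSum.lof k (DivCat k d × DivCat k d)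
      (fun p => (p.1.tensor p.2 ⟶ U) ⊗[k] (X.val p.1 ⊗[k] Y.val p.2)) (V, W))

variable {X Y Z}

lemma coendMk_apply {U V W : DivCat k d} (φ : V.tensor W ⟶ U) (x : X.val V) (y : Y.val W) :
    coendMk X Y V W φ x y = (coendRel X Y U).mkQ (coendι X Y V W φ x y) := rfl

lemma coendMk_act {U V V' W W' : DivCat k d} (g : V ⟶ V') (h : W ⟶ W') (φ : V'.tensor W' ⟶ U)
    (x : X.val V) (y : Y.val W) :
    coendMk X Y V' W' φ (X.act g x) (Y.act h y) =
      coendMk X Y V W (DivCat.tensorHom g h ≫ φ) x y := by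
  rw [eq_comm, ← sub_eq_zero, coendMk_apply, coendMk_apply, ← map_sub, Submodule.mkQ_apply,
    Submodule.Quotient.mk_eq_zero]
  exact Submodule.subset_span ⟨_, _, _, _, g, h, φ, x, y, rfl⟩

lemma coendMk_sum {U V W : DivCat k d} {ι : Type*} (s : Finset ι) (φ : V.tensor W ⟶ U)
    (x : ι → X.val V) (y : Y.val W) :
    coendMk X Y V W φ (∑ i ∈ s, x i) y = ∑ i ∈ s, coendMk X Y V W φ (x i) y :=
  map_sum ((coendMk X Y V W φ).flip y) x s

lemma coendMk_zero {U V W : DivCat k d} (x : X.val V) (y : Y.val W) :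
    coendMk X Y V W (0 : V.tensor W ⟶ U) x y = 0 :=
  map_zero (((coendMk X Y V W (U := U)).flip x).flip y)

variable (b : ∀ V W : DivCat k d, X.val V →ₗ[k] Y.val W →ₗ[k] Z.val (V.tensor W))

/-- The map on the sum of the `Hom(V ⊗ W, U) ⊗ X(V) ⊗ Y(W)` given by bilinear maps
`X(V) × Y(W) → Z(V ⊗ W)`. -/
def coendSumDesc (U : DivCat k d) : CoendSum X Y U →ₗ[k] Z.val U :=
  open scoped Classical in
  DirectSum.toModule k _ _ fun p => TensorProduct.lift
    (LinearMap.lcomp k (Z.val U) (TensorProduct.lift (b p.1 p.2)) ∘ₗ Z.actₗ)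

lemma coendSumDesc_ι {U V W : DivCat k d} (φ : V.tensor W ⟶ U) (x : X.val V) (y : Y.val W) :
    coendSumDesc b U (coendι X Y V W φ x y) = Z.act φ (b V W x y) := by
  classical
  simp only [coendSumDesc, coendι]
  refine (DirectSum.toModule_lof k (V, W) _).trans ?_
  simp [actₗ]

variable (hb : ∀ {V V' W W' : DivCat k d} (g : V ⟶ V') (h : W ⟶ W') (x : X.val V) (y : Y.val W),
  Z.act (DivCat.tensorHom g h) (b V W x y) = b V' W' (X.act g x) (Y.act h y))

include hb in
lemma coendRel_le_ker (U : DivCat k d) : coendRel X Y U ≤ LinearMap.ker (coendSumDesc b U) := by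
  refine Submodule.span_le.2 ?_
  rintro _ ⟨V, V', W, W', g, h, φ, x, y, rfl⟩
  rw [SetLike.mem_coe, LinearMap.mem_ker, map_sub, coendSumDesc_ι, coendSumDesc_ι, act_comp, hb,
    sub_self]

/-- The map on the coend given by natural bilinear maps `X(V) × Y(W) → Z(V ⊗ W)`. -/
def coendDesc (U : DivCat k d) : Coend X Y U →ₗ[k] Z.val U :=
  Submodule.liftQ _ (coendSumDesc b U) (coendRel_le_ker b hb U)

lemma coendDesc_mk {U V W : DivCat k d} (φ : V.tensor W ⟶ U) (x : X.val V) (y : Y.val W) :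
    coendDesc b hb U (coendMk X Y V W φ x y) = Z.act φ (b V W x y) :=
  coendSumDesc_ι b φ x y

lemma coendDesc_map {U U' : DivCat k d} (ψ : U ⟶ U') (c : Coend X Y U) :
    coendDesc b hb U' (coendMap X Y ψ c) = Z.act ψ (coendDesc b hb U c) := by
  have : coendDesc b hb U' ∘ₗ coendMap X Y ψ = Z.act ψ ∘ₗ coendDesc b hb U := by
    refine coend_hom_ext fun V W φ x y => ?_
    rw [LinearMap.comp_apply, LinearMap.comp_apply, coendMap_ι, ← coendMk_apply, ← coendMk_apply,
      coendDesc_mk, coendDesc_mk, act_comp]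
  exact LinearMap.congr_fun this c

/-- Natural bilinear maps `X(V) × Y(W) → Z(V ⊗ W)` that induce bijections on the coends present
`Z` as the internal tensor product of `X` and `Y`. -/
def internalTensorIso (hbij : ∀ U, Function.Bijective (coendDesc b hb U)) :
    internalTensor X Y ≅ Z :=
  isoOfLinearEquiv (fun U => (coendEquiv X Y U).trans (LinearEquiv.ofBijective _ (hbij U)))
    fun {U U'} ψ z => by
      have h : coendEquiv X Y U' ((internalTensor X Y).act ψ z) =
          coendMap X Y ψ (coendEquiv X Y U z) :=
        (coendEquiv X Y U').apply_symm_apply _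
      change coendDesc b hb U' (coendEquiv X Y U' ((internalTensor X Y).act ψ z)) = _
      rw [h, coendDesc_map]
      rfl

end Desc

end SPF

end

end StrictPoly

namespace StrictPoly

noncomputable section

variable {k : Type u} [CommRing k] {d : ℕ}

namespace SPF

/-! ### Presentations and coefficients -/

/-- The action of a morphism of `Γ^d P_k` on `k[Ω] ⊗ V^{⊗ d}`. -/
abbrev actPi (Ω : Type) {V W : DivCat k d} (f : V ⟶ W) : (Ω → V.T) →ₗ[k] (Ω → W.T) :=
  (DivCat.tact f).compLeft Ω

lemma actPi_single {Ω : Type} [DecidableEq Ω] {V W : DivCat k d} (f : V ⟶ W) (w : Ω) (t : V.T) :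
    actPi Ω f (Pi.single w t) = Pi.single w (DivCat.tact f t) := by
  ext v : 1
  exact Pi.apply_single (fun _ => DivCat.tact f) (fun _ => map_zero _) w t v

/-- A presentation of a strict polynomial functor as a quotient of `V ↦ k[Ω] ⊗ V^{⊗ d}`. -/
structure Presentation (Y : SPF k d) (Ω : Type)
    (R : ∀ V : DivCat k d, Submodule k (Ω → V.T)) where
  /-- The quotient map. -/
  proj : ∀ V : DivCat k d, (Ω → V.T) →ₗ[k] Y.val V
  surjective : ∀ V, Function.Surjective (proj V)
  proj_eq_zero : ∀ V z, proj V z = 0 ↔ z ∈ R V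
  act_proj : ∀ {V W : DivCat k d} (f : V ⟶ W) (z : Ω → V.T),
    Y.act f (proj V z) = proj W (actPi Ω f z)

namespace Presentation

variable {Y : SPF k d} {Ω : Type} {R : ∀ V : DivCat k d, Submodule k (Ω → V.T)}
  (P : Presentation Y Ω R)

/-- The map from a presented functor given by a map that kills the relations. -/
def desc {V : DivCat k d} {N : Type*} [AddCommGroup N] [Module k N]
    (f : (Ω → V.T) →ₗ[k] N) (hf : ∀ z ∈ R V, f z = 0) : Y.val V →ₗ[k] N :=
  Submodule.liftQ (LinearMap.ker (P.proj V)) f (fun z hz => hf z ((P.proj_eq_zero V z).1 hz)) ∘ₗ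
    ((P.proj V).quotKerEquivOfSurjective (P.surjective V)).symm.toLinearMap

lemma desc_proj {V : DivCat k d} {N : Type*} [AddCommGroup N] [Module k N]
    (f : (Ω → V.T) →ₗ[k] N) (hf : ∀ z ∈ R V, f z = 0) (z) :
    P.desc f hf (P.proj V z) = f z := by
  have : ((P.proj V).quotKerEquivOfSurjective (P.surjective V)).symm (P.proj V z) =
      Submodule.Quotient.mk z := by
    rw [LinearEquiv.symm_apply_eq]
    rfl
  simp only [desc, LinearMap.comp_apply, LinearEquiv.coe_coe, this]
  exact Submodule.liftQ_apply _ _ _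

end Presentation

/-- Natural maps `c_w : X(V) → V^{⊗ d}`, for `w` in a finite `S_d`-set `Ω` and equivariant up to
the character `ε`, from which an element of `X(V)` can be recovered in `X(V ⊗ k^d)`, with the help
of elements `base w` of `X(k^d)` that are dual to them. -/
structure Coefficients (X : SPF k d) (Ω : Type) [Fintype Ω] [DecidableEq Ω]
    [MulAction (Equiv.Perm (Fin d)) Ω] (ε : Equiv.Perm (Fin d) →* k) where
  /-- The coefficient of an element at `w`. -/
  coeff : ∀ (V : DivCat k d) (_ : Ω), X.val V →ₗ[k] V.T
  /-- The dual elements. -/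
  base : Ω → X.val (DivCat.free k d d)
  coeff_act : ∀ {V W : DivCat k d} (f : V ⟶ W) (w : Ω) (x : X.val V),
    coeff W w (X.act f x) = DivCat.tact f (coeff V w x)
  coeff_smul : ∀ (V : DivCat k d) (σ : Equiv.Perm (Fin d)) (w : Ω) (x : X.val V),
    coeff V (σ • w) x = ε σ • perm k σ (coeff V w x)
  coeff_base : ∀ v w : Ω, coeff _ v (base w) =
    ∑ σ : Equiv.Perm (Fin d), if σ • w = v then ε σ • perm k σ (DivCat.std k d) else 0
  act_inclHom : ∀ (V : DivCat k d) (x : X.val V), X.act V.inclHom x =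
    ∑ w, X.act (DivCat.extHom (DivCat.tmul (coeff V w x) (DivCat.std k d))) (base w)

namespace Coefficients

variable {X : SPF k d} {Ω Ω' : Type} [Fintype Ω] [DecidableEq Ω]
    [MulAction (Equiv.Perm (Fin d)) Ω] {ε : Equiv.Perm (Fin d) →* k} (D : Coefficients X Ω ε)

/-- The family of the products of the coefficients of `x` with a family of tensors. -/
def pair (Ω' : Type) (V W : DivCat k d) : X.val V →ₗ[k] (Ω' → W.T) →ₗ[k]
    (Ω × Ω' → (V.tensor W).T) :=
  LinearMap.mk₂ k (fun x y p => DivCat.tmul (D.coeff V p.1 x) (y p.2))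
    (fun x x' y => funext fun p => by simp only [map_add, LinearMap.add_apply, Pi.add_apply])
    (fun r x y => funext fun p => by simp only [map_smul, LinearMap.smul_apply, Pi.smul_apply])
    (fun x y y' => funext fun p => by simp only [map_add, Pi.add_apply])
    (fun r x y => funext fun p => by simp only [map_smul, Pi.smul_apply])

lemma pair_apply {V W : DivCat k d} (x : X.val V) (y : Ω' → W.T) (p : Ω × Ω') :
    D.pair Ω' V W x y p = DivCat.tmul (D.coeff V p.1 x) (y p.2) := rfl

lemma actPi_pair {V V' W W' : DivCat k d} (g : V ⟶ V') (h : W ⟶ W') (x : X.val V)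
    (y : Ω' → W.T) :
    actPi (Ω × Ω') (DivCat.tensorHom g h) (D.pair Ω' V W x y) =
      D.pair Ω' V' W' (X.act g x) (actPi Ω' h y) := by
  ext p : 1
  rw [pair_apply, D.coeff_act]
  exact DivCat.tact_tensorHom _ _ _ _

/-- The sum over `w` of the products of `c_w(x)` with the tensor `y` in place `w'`. -/
lemma actPi_pair_base [DecidableEq Ω'] {U : DivCat k d} (u : U.T) (w : Ω) (w' : Ω')
    (σ : Equiv.Perm (Fin d)) :
    actPi (Ω × Ω') (DivCat.mulHom k d ≫ DivCat.extHom u)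
      (D.pair Ω' (DivCat.free k d d) (DivCat.free k d d) (D.base w)
        (Pi.single w' (perm k σ (DivCat.std k d)))) =
      ε σ • Pi.single (σ • w, w') (perm k σ u) := by
  ext ⟨v, v'⟩ : 1
  have h : ∀ t : (DivCat.free k d d).T, DivCat.tact (DivCat.mulHom k d ≫
      DivCat.extHom u) (DivCat.tmul (D.coeff _ v (D.base w)) t) = ∑ τ : Equiv.Perm (Fin d),
      if τ • w = v then ε τ • DivCat.tact (DivCat.mulHom k d ≫ DivCat.extHom u)
        (DivCat.tmul (perm k τ (DivCat.std k d)) t) else 0 := fun t => by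
    rw [D.coeff_base]
    simp only [map_sum, LinearMap.sum_apply]
    refine Finset.sum_congr rfl fun τ _ => ?_
    split_ifs
    · simp only [map_smul, LinearMap.smul_apply]
    · simp only [map_zero, LinearMap.zero_apply]
  change DivCat.tact _ (DivCat.tmul (D.coeff _ v (D.base w)) ((Pi.single w' (perm k σ (DivCat.std k d)) :
    Ω' → (DivCat.free k d d).T) v')) = _
  by_cases hv : v' = w'
  · subst hv
    rw [Pi.single_eq_same, h, Finset.sum_eq_single σ]
    · rw [DivCat.tact_mulHom_extHom, if_pos rfl]
      by_cases hw : σ • w = v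
      · subst hw
        simp
      · rw [if_neg hw, Pi.smul_apply, Pi.single_eq_of_ne, smul_zero]
        exact fun h => hw (congrArg Prod.fst h).symm
    · intro τ _ hτ
      rw [DivCat.tact_mulHom_extHom, if_neg hτ, smul_zero, ite_self]
    · simp
  · rw [Pi.single_eq_of_ne hv, map_zero, map_zero, Pi.smul_apply, Pi.single_eq_of_ne, smul_zero]
    exact fun h => hv (congrArg Prod.snd h)

variable [Fintype Ω'] [DecidableEq Ω'] {Y : SPF k d}
  {R : ∀ V : DivCat k d, Submodule k (Ω' → V.T)} (P : Presentation Y Ω' R)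

/-- The inverse of the map from the coend, on `k[Ω × Ω'] ⊗ U^{⊗ d}`. -/
def toCoend (U : DivCat k d) : (Ω × Ω' → U.T) →ₗ[k] Coend X Y U :=
  ∑ p : Ω × Ω', (((coendMk X Y (DivCat.free k d d) (DivCat.free k d d)).flip (D.base p.1)).flip
    (P.proj _ (Pi.single p.2 (DivCat.std k d)))) ∘ₗ
      Linear.rightComp k _ (𝟙 U) ∘ₗ Linear.leftComp k _ (DivCat.mulHom k d) ∘ₗ
        DivCat.extHomₗ U ∘ₗ LinearMap.proj p

lemma toCoend_apply {U : DivCat k d} (z : Ω × Ω' → U.T) :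
    D.toCoend P U z = ∑ p : Ω × Ω', coendMk X Y _ _ (DivCat.mulHom k d ≫ DivCat.extHom (z p))
      (D.base p.1) (P.proj _ (Pi.single p.2 (DivCat.std k d))) := by
  simp only [toCoend, LinearMap.sum_apply, LinearMap.comp_apply, LinearMap.flip_apply,
    Linear.rightComp_apply, Category.comp_id]
  rfl

set_option maxHeartbeats 800000 in
-- As `y` is fixed by the idempotent of the standard tensor, this idempotent can be inserted into
-- `φ` and written as the inclusion of V into V ⊗ k^d followed by the multiplication. The coend
-- relation moves the inclusion onto `x`, where `act_inclHom` expands it in the dual elements. The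
-- morphisms that then act on the dual elements are moved back into `φ`.
lemma coendMk_std {U V : DivCat k d} (φ : V.tensor (DivCat.free k d d) ⟶ U) (x : X.val V)
    (y : Y.val (DivCat.free k d d)) (hy : Y.act (DivCat.extHom (DivCat.std k d)) y = y) :
    coendMk X Y V (DivCat.free k d d) φ x y = ∑ w, coendMk X Y _ _ (DivCat.mulHom k d ≫
      DivCat.extHom (DivCat.tact φ (DivCat.tmul (D.coeff V w x) (DivCat.std k d)))) (D.base w) y := by
  have h₁ : coendMk X Y V _ φ x y =
      coendMk X Y _ _ (DivCat.tensorHom (𝟙 V) (DivCat.extHom (DivCat.std k d)) ≫ φ) x y := by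
    have h := coendMk_act (𝟙 V) (DivCat.extHom (DivCat.std k d)) φ x y
    rwa [X.act_id, hy] at h
  have h₂ : coendMk X Y _ _ (V.mulLeftHom ≫ φ) (X.act V.inclHom x) y =
      coendMk X Y _ _ (DivCat.tensorHom (𝟙 V) (DivCat.extHom (DivCat.std k d)) ≫ φ) x y := by
    have h := coendMk_act V.inclHom (DivCat.extHom (DivCat.std k d)) (V.mulLeftHom ≫ φ) x y
    rwa [hy, ← Category.assoc, DivCat.inclHom_mulLeftHom] at h
  have h₃ : ∀ w, coendMk X Y _ _ (V.mulLeftHom ≫ φ) (X.act (DivCat.extHom (DivCat.tmul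
      (D.coeff V w x) (DivCat.std k d))) (D.base w)) y = coendMk X Y _ _ (DivCat.mulHom k d ≫
        DivCat.extHom (DivCat.tact φ (DivCat.tmul (D.coeff V w x) (DivCat.std k d))))
          (D.base w) y := fun w => by
    have h := coendMk_act (DivCat.extHom (DivCat.tmul (D.coeff V w x) (DivCat.std k d)))
      (DivCat.extHom (DivCat.std k d)) (V.mulLeftHom ≫ φ) (D.base w) y
    rwa [hy, ← Category.assoc, DivCat.extHom_mulLeftHom, Category.assoc, DivCat.extHom_comp] at h
  rw [D.act_inclHom, coendMk_sum] at h₂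
  exact (h₁.trans h₂.symm).trans (Finset.sum_congr rfl fun w _ => h₃ w)

/-- Both sides are linear in `y`, so `y` may be a tensor `t` at one index. It is the image of the
standard tensor under `extHom t`, which the coend relation moves into the morphism, and
`coendMk_std` applies. The formula shows that `toCoend` reaches every class. -/
lemma toCoend_actPi_pair {U V W : DivCat k d} (φ : V.tensor W ⟶ U) (x : X.val V)
    (y : Ω' → W.T) :
    D.toCoend P U (actPi _ φ (D.pair Ω' V W x y)) =
      coendMk X Y V W φ x (P.proj W y) := by
  suffices h : D.toCoend P U ∘ₗ actPi _ φ ∘ₗ D.pair Ω' V W x =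
      coendMk X Y V W φ x ∘ₗ P.proj W from LinearMap.congr_fun h y
  refine LinearMap.pi_ext fun w' t => ?_
  have ht : P.proj W (Pi.single w' t) =
      Y.act (DivCat.extHom t) (P.proj _ (Pi.single w' (DivCat.std k d))) := by
    rw [P.act_proj, actPi_single, DivCat.tact_extHom]
  have hx := coendMk_act (X := X) (Y := Y) (𝟙 V) (DivCat.extHom t) φ x
    (P.proj _ (Pi.single w' (DivCat.std k d)))
  have hy : Y.act (DivCat.extHom (DivCat.std k d)) (P.proj _ (Pi.single w' (DivCat.std k d))) =
      P.proj (DivCat.free k d d) (Pi.single w' (DivCat.std k d)) := by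
    rw [P.act_proj, actPi_single, DivCat.tact_extHom]
  rw [X.act_id, ← ht, D.coendMk_std _ _ _ hy] at hx
  rw [LinearMap.comp_apply, LinearMap.comp_apply, LinearMap.comp_apply, hx, toCoend_apply,
    Fintype.sum_prod_type]
  refine Finset.sum_congr rfl fun w _ => ?_
  rw [Finset.sum_eq_single w']
  · have h : DivCat.extHom (actPi (Ω × Ω') φ (D.pair Ω' V W x (Pi.single w' t)) (w, w')) =
        DivCat.extHom (DivCat.tact (DivCat.tensorHom (𝟙 V) (DivCat.extHom t) ≫ φ)
          (DivCat.tmul (D.coeff V w x) (DivCat.std k d))) := by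
      congr 1
      change DivCat.tact φ (DivCat.tmul (D.coeff V w x) ((Pi.single w' t : Ω' → W.T) w')) = _
      rw [Pi.single_eq_same, DivCat.tact_comp, DivCat.tact_tensorHom, DivCat.tact_id,
        DivCat.tact_extHom]
    exact congrArg (fun f => coendMk X Y _ _ (DivCat.mulHom k d ≫ f) (D.base w)
      (P.proj _ (Pi.single w' (DivCat.std k d)))) h
  · intro v' _ hv'
    have h : actPi (Ω × Ω') φ (D.pair Ω' V W x (Pi.single w' t)) (w, v') = 0 := by
      change DivCat.tact φ (DivCat.tmul (D.coeff V w x) ((Pi.single w' t : Ω' → W.T) v')) = _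
      rw [Pi.single_eq_of_ne hv', map_zero, map_zero]
    have h' : DivCat.mulHom k d ≫ DivCat.extHom (actPi (Ω × Ω') φ
        (D.pair Ω' V W x (Pi.single w' t)) (w, v')) = 0 := by
      rw [h, show DivCat.extHom (0 : U.T) = 0 from map_zero (DivCat.extHomₗ U), Limits.comp_zero]
    exact (congrArg (fun f => coendMk X Y _ _ f (D.base w)
      (P.proj _ (Pi.single v' (DivCat.std k d)))) h').trans (coendMk_zero _ _)
  · simp

variable {Z : SPF k d} {S : ∀ V : DivCat k d, Submodule k (Ω × Ω' → V.T)}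

/-- The internal tensor product of a functor with coefficients indexed by `Ω` and of a quotient of
`k[Ω'] ⊗ V^{⊗ d}` is a quotient of `k[Ω × Ω'] ⊗ V^{⊗ d}`. -/
lemma nonempty_iso (P : Presentation Y Ω' R) (Q : Presentation Z (Ω × Ω') S)
    (h₁ : ∀ (V W : DivCat k d) (x : X.val V), ∀ y ∈ R W, D.pair Ω' V W x y ∈ S (V.tensor W))
    (h₂ : ∀ U : DivCat k d, S U ≤ Submodule.span k {z | ∃ (V W : DivCat k d)
      (φ : V.tensor W ⟶ U) (x : X.val V), ∃ y ∈ R W,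
        z = actPi _ φ (D.pair Ω' V W x y)}) :
    Nonempty (internalTensor X Y ≅ Z) := by
  let b : ∀ V W : DivCat k d, X.val V →ₗ[k] Y.val W →ₗ[k] Z.val (V.tensor W) := fun V W =>
    (P.desc (((D.pair Ω' V W).compr₂ (Q.proj _)).flip) fun y hy => LinearMap.ext fun x =>
      (Q.proj_eq_zero _ _).2 (h₁ V W x y hy)).flip
  have hbp : ∀ V W x y, b V W x (P.proj W y) = Q.proj _ (D.pair Ω' V W x y) := fun V W x y =>
    LinearMap.congr_fun (P.desc_proj _ _ y) x
  have hb : ∀ {V V' W W' : DivCat k d} (g : V ⟶ V') (h : W ⟶ W') (x : X.val V) (y : Y.val W),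
      Z.act (DivCat.tensorHom g h) (b V W x y) = b V' W' (X.act g x) (Y.act h y) := by
    intro V V' W W' g h x y
    obtain ⟨y, rfl⟩ := P.surjective W y
    rw [hbp, Q.act_proj, P.act_proj, hbp, D.actPi_pair]
  have hproj : ∀ U z, coendDesc b hb U (D.toCoend P U z) = Q.proj U z := by
    intro U z
    suffices h : coendDesc b hb U ∘ₗ D.toCoend P U = Q.proj U from LinearMap.congr_fun h z
    refine LinearMap.pi_ext fun p u => ?_
    -- For the identity permutation the formula shows that a single tensor `u` at `p` is itself an
    -- image of a product, so `toCoend_actPi_pair` evaluates `toCoend` on it.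
    have h := D.actPi_pair_base u p.1 p.2 1
    rw [one_smul, map_one, one_smul, perm_one, perm_one] at h
    change _ = (Pi.single p u : Ω × Ω' → U.T) at h
    rw [LinearMap.comp_apply]
    conv_lhs => rw [← h, D.toCoend_actPi_pair, coendDesc_mk, hbp, Q.act_proj, h]
  have hsurj : ∀ U, Function.Surjective (D.toCoend P U) := by
    intro U
    rw [← LinearMap.range_eq_top]
    have h0 : (LinearMap.range (D.toCoend P U)).mkQ = 0 := by
      refine coend_hom_ext fun V W φ x y => ?_
      obtain ⟨y, rfl⟩ := P.surjective W y
      rw [← coendMk_apply, ← D.toCoend_actPi_pair P, LinearMap.zero_apply, Submodule.mkQ_apply,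
        Submodule.Quotient.mk_eq_zero]
      exact LinearMap.mem_range_self _ _
    rw [← Submodule.ker_mkQ (LinearMap.range _), h0, LinearMap.ker_zero]
  have hS : ∀ U, S U ≤ LinearMap.ker (D.toCoend P U) := by
    intro U
    refine (h₂ U).trans (Submodule.span_le.2 ?_)
    rintro _ ⟨V, W, φ, x, y, hy, rfl⟩
    rw [SetLike.mem_coe, LinearMap.mem_ker, D.toCoend_actPi_pair, (P.proj_eq_zero _ _).2 hy,
      map_zero]
  -- The triangle `hproj` with `toCoend` surjective reduces injectivity to the inclusion `hS` of the
  -- relations in the kernel. Surjectivity is inherited from that of `Q.proj`.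
  refine ⟨internalTensorIso b hb fun U => ⟨?_, fun z => ?_⟩⟩
  · rw [← LinearMap.ker_eq_bot, LinearMap.ker_eq_bot']
    intro c hc
    obtain ⟨z, rfl⟩ := hsurj U c
    rw [hproj, Q.proj_eq_zero] at hc
    exact hS U hc
  · obtain ⟨z, rfl⟩ := Q.surjective U z
    exact ⟨_, hproj U z⟩

end Coefficients

end SPF

end

end StrictPoly

namespace StrictPoly

noncomputable section

variable {k : Type u} [CommRing k] {d : ℕ}

namespace SPF

/-! ### Relations on `k[Ω] ⊗ V^{⊗ d}` -/

section Relations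

/-- The sign character of the symmetric group, with values in `k`. -/
def sgnChar (k : Type u) [CommRing k] (d : ℕ) : Equiv.Perm (Fin d) →* k :=
  (Int.castRingHom k : ℤ →* k).comp ((Units.coeHom ℤ).comp Equiv.Perm.sign)

lemma sgnChar_sq (σ : Equiv.Perm (Fin d)) : sgnChar k d σ * sgnChar k d σ = 1 := by
  rw [← map_mul]
  simp [sgnChar]

lemma sgnChar_swap {i j : Fin d} (hij : i ≠ j) : sgnChar k d (Equiv.swap i j) = -1 := by
  simp [sgnChar, Equiv.Perm.sign_swap hij]

variable (Ω : Type) [DecidableEq Ω] [MulAction (Equiv.Perm (Fin d)) Ω]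
  (ε : Equiv.Perm (Fin d) →* k)

/-- The relations `σ w ⊗ σ t ∼ ε(σ) w ⊗ t`. -/
def charRel (V : DivCat k d) : Submodule k (Ω → V.T) :=
  Submodule.span k {z | ∃ (σ : Equiv.Perm (Fin d)) (w : Ω) (t : V.T),
    z = Pi.single (σ • w) (perm k σ t) - ε σ • (Pi.single w t : Ω → V.T)}

/-- The span of the `w ⊗ x₁ ⊗ ⋯ ⊗ x_d` with `x_i = x_j` for two places `i`, `j` whose exchange
fixes `w`. -/
def diagRel (V : DivCat k d) : Submodule k (Ω → V.T) :=
  Submodule.span k {z | ∃ (i j : Fin d) (w : Ω) (x : Fin d → V.carrier), i ≠ j ∧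
    Equiv.swap i j • w = w ∧ x i = x j ∧ z = Pi.single w (PiTensorProduct.tprod k x)}

/-- The relations of an exterior power. -/
def extRel (V : DivCat k d) : Submodule k (Ω → V.T) := charRel Ω (sgnChar k d) V ⊔ diagRel Ω V

variable {Ω ε}

lemma single_perm_sub_mem (σ : Equiv.Perm (Fin d)) (w : Ω) {V : DivCat k d} (t : V.T) :
    Pi.single (σ • w) (perm k σ t) - ε σ • (Pi.single w t : Ω → V.T) ∈ charRel Ω ε V :=
  Submodule.subset_span ⟨σ, w, t, rfl⟩

lemma perm_swap_tprod {M : Type u} [AddCommGroup M] [Module k M] {i j : Fin d} {x : Fin d → M}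
    (hx : x i = x j) :
    perm k (Equiv.swap i j) (PiTensorProduct.tprod k x) = PiTensorProduct.tprod k x := by
  rw [perm_tprod]
  congr 1
  ext p
  rcases eq_or_ne p i with rfl | hi
  · simp [hx]
  · rcases eq_or_ne p j with rfl | hj
    · simp [hx]
    · simp [Equiv.swap_apply_of_ne_of_ne, hi, hj]

/-- The relations are spanned by pure tensors with two equal factors. Since V is finitely generated
projective, these already give every tensor fixed by the exchange (`mem_altPair`). -/
lemma single_mem_diagRel {i j : Fin d} (hij : i ≠ j) {w : Ω} (hw : Equiv.swap i j • w = w)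
    {V : DivCat k d} {t : V.T} (ht : perm k (Equiv.swap i j) t = t) :
    (Pi.single w t : Ω → V.T) ∈ diagRel Ω V := by
  have h : altPair k i j V.carrier ≤ (diagRel Ω V).comap (LinearMap.single k (fun _ => V.T) w) := by
    refine Submodule.span_le.2 ?_
    rintro _ ⟨x, hx, rfl⟩
    exact Submodule.subset_span ⟨i, j, w, x, hij, hw, hx, rfl⟩
  exact h (mem_altPair hij ht)

end Relations

/-! ### Coefficients of a presented functor -/

section OfPresentation

variable {Ω : Type} [DecidableEq Ω] [MulAction (Equiv.Perm (Fin d)) Ω]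

/-- The coefficient at `w` of an element of `k[Ω] ⊗ V^{⊗ d}`, modulo the relations of the
character `ε`. -/
def coeffSum (ε : Equiv.Perm (Fin d) →* k) (w : Ω) (V : DivCat k d) : (Ω → V.T) →ₗ[k] V.T :=
  ∑ σ : Equiv.Perm (Fin d), ε σ • (perm k σ ∘ₗ LinearMap.proj (σ⁻¹ • w))

variable {ε : Equiv.Perm (Fin d) →* k}

omit [DecidableEq Ω] in
lemma coeffSum_apply (w : Ω) {V : DivCat k d} (z : Ω → V.T) :
    coeffSum ε w V z = ∑ σ : Equiv.Perm (Fin d), ε σ • perm k σ (z (σ⁻¹ • w)) := by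
  simp [coeffSum]

lemma coeffSum_single (v w : Ω) {V : DivCat k d} (t : V.T) :
    coeffSum ε v V (Pi.single w t) =
      ∑ σ : Equiv.Perm (Fin d), if σ • w = v then ε σ • perm k σ t else 0 := by
  rw [coeffSum_apply]
  refine Finset.sum_congr rfl fun σ _ => ?_
  split_ifs with h
  · rw [← h, inv_smul_smul, Pi.single_eq_same]
  · rw [Pi.single_eq_of_ne, map_zero, smul_zero]
    rintro rfl
    exact h (smul_inv_smul _ _)

omit [DecidableEq Ω] in
lemma coeffSum_act (w : Ω) {V W : DivCat k d} (f : V ⟶ W) (z : Ω → V.T) :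
    coeffSum ε w W (actPi Ω f z) = DivCat.tact f (coeffSum ε w V z) := by
  simp only [coeffSum_apply, map_sum, map_smul, ← DivCat.perm_tact]
  rfl

omit [DecidableEq Ω] in
lemma coeffSum_smul (σ : Equiv.Perm (Fin d)) (w : Ω) {V : DivCat k d} (z : Ω → V.T) :
    coeffSum ε (σ • w) V z = ε σ • perm k σ (coeffSum ε w V z) := by
  simp only [coeffSum_apply, map_sum, map_smul, Finset.smul_sum, smul_smul, ← perm_mul, ← map_mul]
  refine (Fintype.sum_equiv (Equiv.mulLeft σ) _ _ fun τ => ?_).symm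
  rw [Equiv.coe_mulLeft, mul_inv_rev, inv_mul_cancel_right]

/-- Right translation of the summation index by σ costs ε(σ), and ε(σ)² = 1 makes this the factor in
the relation. -/
lemma coeffSum_charRel (hε : ∀ σ, ε σ * ε σ = 1) (w : Ω) {V : DivCat k d} {z : Ω → V.T}
    (hz : z ∈ charRel Ω ε V) : coeffSum ε w V z = 0 := by
  suffices h : charRel Ω ε V ≤ LinearMap.ker (coeffSum ε w V) from h hz
  refine Submodule.span_le.2 ?_
  rintro _ ⟨σ, v, t, rfl⟩
  rw [SetLike.mem_coe, LinearMap.mem_ker, map_sub, map_smul, coeffSum_single, coeffSum_single,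
    sub_eq_zero, Finset.smul_sum]
  refine Fintype.sum_equiv (Equiv.mulRight σ) _ _ fun τ => ?_
  have h : ε σ * (ε τ * ε σ) = ε τ := by rw [mul_left_comm, hε, mul_one]
  rw [Equiv.coe_mulRight, smul_ite, smul_zero, mul_smul, map_mul, perm_mul, ← mul_smul (ε σ), h]

/-- The terms of σ and of σ composed with the exchange have the same index and the same tensor but
opposite signs. -/
lemma coeffSum_diagRel (w : Ω) {V : DivCat k d} {z : Ω → V.T} (hz : z ∈ diagRel Ω V) :
    coeffSum (sgnChar k d) w V z = 0 := by
  suffices h : diagRel Ω V ≤ LinearMap.ker (coeffSum (sgnChar k d) w V) from h hz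
  refine Submodule.span_le.2 ?_
  rintro _ ⟨i, j, v, x, hij, hv, hx, rfl⟩
  rw [SetLike.mem_coe, LinearMap.mem_ker, coeffSum_single]
  refine Finset.sum_involution (fun σ _ => σ * Equiv.swap i j) (fun σ _ => ?_) (fun σ _ _ h => ?_)
    (fun _ _ => Finset.mem_univ _) fun σ _ => ?_
  · rw [mul_smul, hv, perm_mul, perm_swap_tprod hx, map_mul, sgnChar_swap hij]
    split_ifs <;> simp
  · exact hij (Equiv.swap_eq_one_iff.1 (mul_eq_left.1 h))
  · simp [mul_assoc]

/-- The coefficients of a functor presented by relations that contain the relations of a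
character. -/
def Coefficients.ofPresentation [Fintype Ω] {X : SPF k d}
    {R : ∀ V : DivCat k d, Submodule k (Ω → V.T)}
    (P : Presentation X Ω R) (hε : ∀ σ, ε σ * ε σ = 1) (hR : ∀ V, charRel Ω ε V ≤ R V)
    (hker : ∀ (w : Ω) (V : DivCat k d), ∀ z ∈ R V, coeffSum ε w V z = 0) :
    Coefficients X Ω ε where
  coeff V w := P.desc (coeffSum ε w V) (hker w V)
  base w := P.proj _ (Pi.single w (DivCat.std k d))
  coeff_act f w x := by
    obtain ⟨z, rfl⟩ := P.surjective _ x
    rw [P.act_proj, P.desc_proj, P.desc_proj, coeffSum_act]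
  coeff_smul V σ w x := by
    obtain ⟨z, rfl⟩ := P.surjective _ x
    rw [P.desc_proj, P.desc_proj, coeffSum_smul]
  coeff_base v w := by
    rw [P.desc_proj, coeffSum_single]
  act_inclHom V x := by
    obtain ⟨z, rfl⟩ := P.surjective _ x
    simp only [P.act_proj, P.desc_proj, actPi_single, DivCat.tact_extHom]
    rw [← map_sum, Finset.univ_sum_single fun w => DivCat.tmul (coeffSum ε w V z) (DivCat.std k d)]
    -- On a tensor `t` at `v` the left side is the sum of the t ⊗ σ(std) at `v`, and the right side
    -- is the sum of the ε(σ) σ(t ⊗ σ⁻¹(std)) at σ • v. Modulo the relations of the character they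
    -- agree term by term after replacing σ by σ⁻¹.
    have key : P.proj _ ∘ₗ actPi Ω V.inclHom = P.proj _ ∘ₗ LinearMap.pi fun w =>
        DivCat.tmul.flip (DivCat.std k d) ∘ₗ coeffSum ε w V := by
      refine LinearMap.pi_ext fun v t => ?_
      have h₁ : (LinearMap.pi fun w => DivCat.tmul.flip (DivCat.std k d) ∘ₗ coeffSum ε w V)
          (Pi.single v t) = ∑ σ : Equiv.Perm (Fin d), ε σ • (Pi.single (σ • v)
            (perm k σ (DivCat.tmul t (perm k σ⁻¹ (DivCat.std k d)))) :
              Ω → (V.tensor (DivCat.free k d d)).T) := by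
        ext w : 1
        rw [LinearMap.pi_apply, LinearMap.comp_apply, coeffSum_single, LinearMap.flip_apply,
          map_sum, LinearMap.sum_apply, Finset.sum_apply]
        refine Finset.sum_congr rfl fun σ _ => ?_
        rw [Pi.smul_apply, DivCat.perm_tmul, ← perm_mul, mul_inv_cancel, perm_one]
        split_ifs with h
        · rw [← h, Pi.single_eq_same, map_smul, LinearMap.smul_apply]
        · rw [Pi.single_eq_of_ne' h, smul_zero, map_zero, LinearMap.zero_apply]
      rw [LinearMap.comp_apply, LinearMap.comp_apply, h₁, actPi_single, DivCat.tact_inclHom, map_sum,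
        show (Pi.single v (∑ σ : Equiv.Perm (Fin d), DivCat.tmul t (perm k σ (DivCat.std k d))) :
          Ω → (V.tensor (DivCat.free k d d)).T) = ∑ σ : Equiv.Perm (Fin d), Pi.single v
            (DivCat.tmul t (perm k σ (DivCat.std k d))) from
          map_sum (LinearMap.single k (fun _ => (V.tensor (DivCat.free k d d)).T) v) _ _, map_sum]
      refine Fintype.sum_equiv (Equiv.inv _) _ _ fun σ => ?_
      rw [Equiv.inv_apply, inv_inv, map_smul]
      have h := (P.proj_eq_zero _ _).2 (hR _ (single_perm_sub_mem (ε := ε) σ⁻¹ v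
        (DivCat.tmul t (perm k σ (DivCat.std k d)))))
      rw [map_sub, sub_eq_zero, map_smul] at h
      rw [h, smul_smul, hε, one_smul]
    exact LinearMap.congr_fun key z

lemma Coefficients.ofPresentation_coeff [Fintype Ω] {X : SPF k d}
    {R : ∀ V : DivCat k d, Submodule k (Ω → V.T)}
    (P : Presentation X Ω R) (hε : ∀ σ, ε σ * ε σ = 1) (hR : ∀ V, charRel Ω ε V ≤ R V)
    (hker : ∀ (w : Ω) (V : DivCat k d), ∀ z ∈ R V, coeffSum ε w V z = 0) (w : Ω) (V : DivCat k d)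
    (z : Ω → V.T) :
    (Coefficients.ofPresentation P hε hR hker).coeff V w (P.proj V z) = coeffSum ε w V z :=
  P.desc_proj _ (hker w V) z

end OfPresentation

end SPF

end

end StrictPoly

namespace StrictPoly

noncomputable section

variable {k : Type u} [CommRing k] {d : ℕ}

/-! ### Words in the basis vectors of k^d -/

namespace DivCat

/-- The tensor `e_{q 1} ⊗ ⋯ ⊗ e_{q d}` of basis vectors of `k^d`. -/
def wordT (k : Type u) [CommRing k] {d : ℕ} (q : Fin d → Fin d) : (free k d d).T :=
  PiTensorProduct.tprod k (fun p => (Pi.single (q p) 1 : Fin d → k))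

lemma perm_wordT (σ : Equiv.Perm (Fin d)) (q : Fin d → Fin d) :
    perm k σ (wordT k q) = wordT k (q ∘ σ.symm) := perm_tprod _ _

lemma tact_mulHom_wordT (q g : Fin d → Fin d) :
    tact (mulHom k d) (tmul (wordT k q) (wordT k g)) = if q = g then wordT k g else 0 := by
  have h : tact (mulHom k d) (tmul (wordT k q) (wordT k g)) = PiTensorProduct.tprod k
      (fun p => (Pi.single (q p) 1 * Pi.single (g p) 1 : Fin d → k)) := by
    change actT (PiTensorProduct.tprod k fun _ : Fin d => mulStd k d) (tmulT
      (PiTensorProduct.tprod k fun p => (Pi.single (q p) 1 : Fin d → k))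
      (PiTensorProduct.tprod k fun p => (Pi.single (g p) 1 : Fin d → k))) = _
    rw [tmulT_tprod, actT_tprod]
    rfl
  rw [h]
  split_ifs with hq
  · subst hq
    simp only [← Pi.single_mul, one_mul]
    rfl
  · obtain ⟨p, hp⟩ := Function.ne_iff.1 hq
    refine tprod_eq_zero p ?_
    ext a
    rcases eq_or_ne a (q p) with rfl | ha
    · simp [Pi.single_eq_of_ne hp]
    · simp [Pi.single_eq_of_ne ha]

/-- A word `g` and a tensor `u₁ ⊗ ⋯ ⊗ u_d` with `u_{g p} = u_p` are related by a morphism. -/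
lemma exists_tact_wordT {U : DivCat k d} (g : Fin d → Fin d) (u : Fin d → U.carrier)
    (hu : ∀ p, u (g p) = u p) :
    ∃ ψ : free k d d ⟶ U, tact ψ (wordT k g) = PiTensorProduct.tprod k u := by
  classical
  let E : (Fin d → Fin d) → TPow k d ((Fin d → k) →ₗ[k] U.carrier) := fun q =>
    PiTensorProduct.tprod k fun p =>
      (LinearMap.proj (q p) : (Fin d → k) →ₗ[k] k).smulRight (u (q p))
  -- The sum runs over the orbit of `g` and not over the permutations: each word occurs once, so the
  -- value on `g` has coefficient 1 and not the order of a stabilizer.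
  let s : Finset (Fin d → Fin d) :=
    Finset.univ.image fun σ : Equiv.Perm (Fin d) => g ∘ σ.symm
  have hE : ∑ q ∈ s, E q ∈ DPow k d ((Fin d → k) →ₗ[k] U.carrier) := by
    intro σ _
    rw [map_sum]
    refine Finset.sum_bij' (fun q _ => q ∘ σ.symm) (fun q _ => q ∘ σ) ?_ ?_ ?_ ?_ ?_
    · intro q hq
      obtain ⟨τ, -, rfl⟩ := Finset.mem_image.1 hq
      exact Finset.mem_image.2 ⟨σ * τ, Finset.mem_univ _, rfl⟩
    · intro q hq
      obtain ⟨τ, -, rfl⟩ := Finset.mem_image.1 hq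
      exact Finset.mem_image.2 ⟨σ⁻¹ * τ, Finset.mem_univ _, rfl⟩
    · intro q _
      ext p
      simp
    · intro q _
      ext p
      simp
    · intro q _
      exact perm_tprod _ _
  refine ⟨⟨_, hE⟩, ?_⟩
  change actT (∑ q ∈ s, E q) (PiTensorProduct.tprod k fun p => (Pi.single (g p) 1 : Fin d → k)) = _
  rw [map_sum, LinearMap.sum_apply, Finset.sum_eq_single g]
  · rw [actT_tprod]
    congr 1
    ext p
    simp [hu]
  · intro q _ hq
    obtain ⟨p, hp⟩ := Function.ne_iff.1 hq
    rw [actT_tprod]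
    exact tprod_eq_zero p (by simp [Pi.single_eq_of_ne hp])
  · intro h
    exact (h (Finset.mem_image.2 ⟨1, Finset.mem_univ _, rfl⟩)).elim

end DivCat

namespace SPF

/-! ### Products of coefficients with relations -/

namespace Coefficients

variable {X : SPF k d} {Ω Ω' : Type} [Fintype Ω] [DecidableEq Ω]
    [MulAction (Equiv.Perm (Fin d)) Ω] [Fintype Ω'] [DecidableEq Ω']
    [MulAction (Equiv.Perm (Fin d)) Ω'] {ε ε' : Equiv.Perm (Fin d) →* k} (D : Coefficients X Ω ε)

omit [Fintype Ω'] [MulAction (Equiv.Perm (Fin d)) Ω'] in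
lemma pair_single {V W : DivCat k d} (x : X.val V) (w' : Ω') (t : W.T) :
    D.pair Ω' V W x (Pi.single w' t) =
      ∑ w, Pi.single (w, w') (DivCat.tmul (D.coeff V w x) t) := by
  ext ⟨v, v'⟩ : 1
  rw [Finset.sum_apply, Finset.sum_eq_single v]
  · change DivCat.tmul (D.coeff V v x) ((Pi.single w' t : Ω' → W.T) v') = _
    rcases eq_or_ne v' w' with rfl | h
    · rw [Pi.single_eq_same, Pi.single_eq_same]
    · rw [Pi.single_eq_of_ne h, map_zero, Pi.single_eq_of_ne]
      exact fun e => h (congrArg Prod.snd e)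
  · intro w _ hw
    exact Pi.single_eq_of_ne (fun e => hw (congrArg Prod.fst e).symm) _
  · simp

omit [Fintype Ω'] in
-- After reindexing the sum by σ, the coefficient at σ • w is ε(σ) times the permuted coefficient at
-- w. So each term is ε(σ) times a relation for the product of the two characters.
lemma pair_mem_charRel (hε : ∀ σ, ε σ * ε σ = 1) {V W : DivCat k d} (x : X.val V)
    {y : Ω' → W.T} (hy : y ∈ charRel Ω' ε' W) :
    D.pair Ω' V W x y ∈ charRel (Ω × Ω') (ε * ε') (V.tensor W) := by
  suffices h : charRel Ω' ε' W ≤ (charRel (Ω × Ω') (ε * ε') (V.tensor W)).comap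
      (D.pair Ω' V W x) from h hy
  refine Submodule.span_le.2 ?_
  rintro _ ⟨σ, w', t, rfl⟩
  rw [SetLike.mem_coe, Submodule.mem_comap, map_sub, map_smul, D.pair_single, D.pair_single,
    ← Equiv.sum_comp (MulAction.toPerm σ), Finset.smul_sum, ← Finset.sum_sub_distrib]
  refine Submodule.sum_mem _ fun w _ => ?_
  have h := Submodule.smul_mem _ (ε σ) (single_perm_sub_mem (ε := ε * ε') σ (w, w')
    (DivCat.tmul (D.coeff V w x) t))
  rw [smul_sub, smul_smul, MonoidHom.mul_apply, ← mul_assoc, hε, one_mul, DivCat.perm_tmul,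
    ← Pi.single_smul] at h
  rwa [MulAction.toPerm_apply, D.coeff_smul, map_smul, LinearMap.smul_apply]

omit [Fintype Ω'] in
-- The exchange acts on the index `w`. Two indices that it interchanges cancel by the sign relation.
-- At a fixed index the coefficient is a tensor fixed by the exchange, which is a diagonal relation.
lemma pair_mem_extRel (D : Coefficients X Ω 1) {V W : DivCat k d} (x : X.val V)
    {y : Ω' → W.T} (hy : y ∈ diagRel Ω' W) :
    D.pair Ω' V W x y ∈ extRel (Ω × Ω') (V.tensor W) := by
  suffices h : diagRel Ω' W ≤ (extRel (Ω × Ω') (V.tensor W)).comap (D.pair Ω' V W x) from h hy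
  refine Submodule.span_le.2 ?_
  rintro _ ⟨i, j, w', y, hij, hw', hy, rfl⟩
  have hs : ∀ w, D.coeff V (Equiv.swap i j • w) x =
      perm k (Equiv.swap i j) (D.coeff V w x) := fun w => by
    rw [D.coeff_smul, MonoidHom.one_apply, one_smul]
  rw [SetLike.mem_coe, Submodule.mem_comap, D.pair_single, ← Submodule.Quotient.mk_eq_zero,
    ← Submodule.mkQ_apply, map_sum]
  refine Finset.sum_involution (fun w _ => Equiv.swap i j • w) (fun w _ => ?_) (fun w _ h hw => ?_)
    (fun _ _ => Finset.mem_univ _) fun w _ => ?_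
  · have h := Submodule.mem_sup_left (T := diagRel (Ω × Ω') (V.tensor W)) (single_perm_sub_mem
      (ε := sgnChar k d) (Equiv.swap i j) (w, w')
        (DivCat.tmul (D.coeff V w x) (PiTensorProduct.tprod k y)))
    rw [← map_add, Submodule.mkQ_apply, Submodule.Quotient.mk_eq_zero, hs, add_comm]
    rw [sgnChar_swap hij, neg_one_smul, sub_neg_eq_add, DivCat.perm_tmul, perm_swap_tprod hy,
      Prod.smul_mk, hw'] at h
    exact h
  · refine h ?_
    rw [Submodule.mkQ_apply, Submodule.Quotient.mk_eq_zero]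
    refine Submodule.mem_sup_right (single_mem_diagRel hij ?_ ?_)
    · rw [Prod.smul_mk, hw, hw']
    · rw [DivCat.perm_tmul, perm_swap_tprod hy, ← hs, hw]
  · rw [smul_smul, Equiv.swap_mul_self, one_smul]

omit [Fintype Ω'] in
-- Here the coefficients are sums over all permutations, and left multiplication by the exchange has
-- no fixed points on the group. Every term therefore cancels against another one by the character
-- relation, and no diagonal relation is needed. This is the contrast with Γ.
lemma ofPresentation_pair_mem_charRel {R : ∀ V : DivCat k d, Submodule k (Ω → V.T)}
    (P : Presentation X Ω R) (hε : ∀ σ, ε σ * ε σ = 1) (hR : ∀ V, charRel Ω ε V ≤ R V)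
    (hker : ∀ (w : Ω) (V : DivCat k d), ∀ z ∈ R V, coeffSum ε w V z = 0) {V W : DivCat k d}
    (x : X.val V) {y : Ω' → W.T} (hy : y ∈ diagRel Ω' W) :
    (ofPresentation P hε hR hker).pair Ω' V W x y ∈
      charRel (Ω × Ω') (ε * sgnChar k d) (V.tensor W) := by
  suffices h : diagRel Ω' W ≤ (charRel (Ω × Ω') (ε * sgnChar k d) (V.tensor W)).comap
      ((ofPresentation P hε hR hker).pair Ω' V W x) from h hy
  refine Submodule.span_le.2 ?_
  rintro _ ⟨i, j, w', y, hij, hw', hy, rfl⟩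
  obtain ⟨z, rfl⟩ := P.surjective _ x
  have key : (charRel (Ω × Ω') (ε * sgnChar k d) (V.tensor W)).mkQ ∘ₗ
      ((ofPresentation P hε hR hker).pair Ω' V W).flip
        (Pi.single w' (PiTensorProduct.tprod k y)) ∘ₗ P.proj V = 0 := by
    refine LinearMap.pi_ext fun v t => ?_
    have h₁ : (ofPresentation P hε hR hker).pair Ω' V W (P.proj V (Pi.single v t))
        (Pi.single w' (PiTensorProduct.tprod k y)) = ∑ σ : Equiv.Perm (Fin d),
          ε σ • (Pi.single (σ • v, w')
            (DivCat.tmul (perm k σ t) (PiTensorProduct.tprod k y)) :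
              Ω × Ω' → (V.tensor W).T) := by
      ext ⟨u, u'⟩ : 1
      rw [pair_apply, ofPresentation_coeff, coeffSum_single, map_sum, LinearMap.sum_apply,
        Finset.sum_apply]
      refine Finset.sum_congr rfl fun σ _ => ?_
      rw [Pi.smul_apply]
      dsimp only
      by_cases hu : u' = w'
      · subst hu
        split_ifs with h
        · rw [← h, Pi.single_eq_same, Pi.single_eq_same, map_smul, LinearMap.smul_apply]
        · rw [map_zero, LinearMap.zero_apply, Pi.single_eq_of_ne, smul_zero]
          exact fun e => h (congrArg Prod.fst e).symm
      · rw [Pi.single_eq_of_ne hu, map_zero, Pi.single_eq_of_ne, smul_zero]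
        exact fun e => hu (congrArg Prod.snd e)
    rw [LinearMap.comp_apply, LinearMap.comp_apply, LinearMap.flip_apply, h₁, map_sum,
      LinearMap.zero_apply]
    refine Finset.sum_involution (fun σ _ => Equiv.swap i j * σ) (fun σ _ => ?_)
      (fun σ _ _ h => ?_) (fun _ _ => Finset.mem_univ _) fun σ _ => ?_
    · have h := Submodule.smul_mem _ (ε (Equiv.swap i j) * ε σ) (single_perm_sub_mem
        (ε := ε * sgnChar k d) (Equiv.swap i j) (σ • v, w')
          (DivCat.tmul (perm k σ t) (PiTensorProduct.tprod k y)))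
      -- The factor ε(swap) ε(σ) gives the two cancelling terms the weights that they have in the
      -- sum. The sign of the exchange provides the minus.
      have e : ε (Equiv.swap i j) * ε σ * (ε * sgnChar k d) (Equiv.swap i j) = -ε σ := by
        rw [MonoidHom.mul_apply, sgnChar_swap hij, mul_neg_one, mul_neg,
          mul_right_comm, hε, one_mul]
      rw [smul_sub, smul_smul, e, neg_smul, sub_neg_eq_add, DivCat.perm_tmul, perm_swap_tprod hy,
        Prod.smul_mk, hw', ← perm_mul, ← mul_smul (Equiv.swap i j), ← map_mul] at h
      rwa [← map_add, Submodule.mkQ_apply, Submodule.Quotient.mk_eq_zero, add_comm]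
    · exact hij (Equiv.swap_eq_one_iff.1 (mul_eq_right.1 h))
    · rw [← mul_assoc, Equiv.swap_mul_self, one_mul]
  rw [SetLike.mem_coe, Submodule.mem_comap]
  exact (Submodule.Quotient.mk_eq_zero _).1 (LinearMap.congr_fun key z)

/-- The span of the images of the products with elements of `R`. -/
def pairSpan (R : ∀ V : DivCat k d, Submodule k (Ω' → V.T)) (U : DivCat k d) :
    Submodule k (Ω × Ω' → U.T) :=
  Submodule.span k {z | ∃ (V W : DivCat k d) (φ : V.tensor W ⟶ U) (x : X.val V), ∃ y ∈ R W,
    z = actPi _ φ (D.pair Ω' V W x y)}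

omit [Fintype Ω'] in
-- The dual element at `w`, paired with the relation of `ε'` at `w'`, has its two terms at (σ • w, σ
-- • w') and (w, w'). Up to the factor ε(σ) this is the relation of the product character.
lemma charRel_le_pairSpan (hε : ∀ σ, ε σ * ε σ = 1)
    {R : ∀ V : DivCat k d, Submodule k (Ω' → V.T)} (hR : ∀ V, charRel Ω' ε' V ≤ R V)
    (U : DivCat k d) : charRel (Ω × Ω') (ε * ε') U ≤ D.pairSpan R U := by
  refine Submodule.span_le.2 ?_
  rintro _ ⟨σ, ⟨w, w'⟩, u, rfl⟩
  have h : actPi (Ω × Ω') (DivCat.mulHom k d ≫ DivCat.extHom u) (D.pair Ω' _ _ (D.base w)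
      (Pi.single (σ • w') (perm k σ (DivCat.std k d)) -
        ε' σ • (Pi.single w' (DivCat.std k d) : Ω' → (DivCat.free k d d).T))) ∈
          D.pairSpan R U :=
    Submodule.subset_span ⟨_, _, _, _, _, hR _ (single_perm_sub_mem _ _ _), rfl⟩
  have h₁ := D.actPi_pair_base u w w' 1
  rw [one_smul, map_one, one_smul, perm_one, perm_one] at h₁
  rw [map_sub, map_sub, map_smul, map_smul, D.actPi_pair_base, h₁] at h
  have h' := Submodule.smul_mem _ (ε σ) h
  rwa [smul_sub, smul_smul, smul_smul, hε, one_smul, ← MonoidHom.mul_apply] at h'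

/-- The word with `j` replaced by `i`. -/
def collapse (i j : Fin d) : Fin d → Fin d := Function.update id j i

/-- The collapsed word is injective except that it agrees at `i` and `j`, so a permutation that
preserves it can only exchange these two places. -/
lemma swap_of_collapse_comp {i j : Fin d} (hij : i ≠ j) {σ : Equiv.Perm (Fin d)}
    (h : collapse i j ∘ σ.symm = collapse i j) : σ = 1 ∨ σ = Equiv.swap i j := by
  have hi : collapse i j i = i := Function.update_of_ne hij _ _
  have hj : collapse i j j = i := Function.update_self _ _ _
  have hg : ∀ a b, collapse i j a = collapse i j b → a = b ∨ (a = i ∧ b = j) ∨ (a = j ∧ b = i) := by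
    intro a b hab
    unfold collapse at hab
    by_cases ha : a = j <;> by_cases hb : b = j <;> simp_all
  have hσ : ∀ a, σ.symm a = a ∨ (σ.symm a = i ∧ a = j) ∨ (σ.symm a = j ∧ a = i) := fun a =>
    hg _ _ (congrFun h a)
  have hinj := σ.symm.injective
  rcases hσ i with h₁ | ⟨-, h₁⟩ | ⟨h₁, -⟩
  · left
    rw [← Equiv.symm_symm σ, show σ.symm = 1 from ?_]
    · rfl
    ext a
    rcases hσ a with h₂ | ⟨h₂, h₃⟩ | ⟨h₂, h₃⟩
    · rw [h₂]; rfl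
    · exact (hij ((hinj (h₁.trans h₂.symm)).trans h₃)).elim
    · rw [h₃, h₁] at h₂
      exact (hij h₂).elim
  · exact (hij h₁).elim
  · right
    rw [← Equiv.symm_symm σ, show σ.symm = Equiv.swap i j from ?_, Equiv.symm_swap]
    ext a
    rcases hσ a with h₂ | ⟨h₂, h₃⟩ | ⟨h₂, h₃⟩
    · rw [h₂, Equiv.swap_apply_of_ne_of_ne]
      · rintro rfl
        exact hij (h₂.symm.trans h₁)
      · rintro rfl
        exact hij (hinj (h₁.trans h₂.symm))
    · rw [h₂, h₃, Equiv.swap_apply_right]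
    · rw [h₂, h₃, Equiv.swap_apply_left]

open scoped Classical in
omit [Fintype Ω'] in
-- Pair an element whose coefficients are orbit sums of the collapsed word with that same word at
-- `w'`. The multiplication of k^d keeps only the occurrences of this word, and the permutations
-- preserving it fix `w`, so only the index `w` survives. Since `hD` counts each word once, the
-- result has coefficient 1. A sum over permutations would count the identity and the exchange and
-- give 2.
lemma diagRel_le_pairSpan {R : ∀ V : DivCat k d, Submodule k (Ω' → V.T)}
    (hR : ∀ V, diagRel Ω' V ≤ R V)
    (hD : ∀ (w : Ω) (g : Fin d → Fin d), ∃ x : X.val (DivCat.free k d d), ∀ v,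
      D.coeff _ v x = ∑ q : Fin d → Fin d,
        if ∃ σ : Equiv.Perm (Fin d), σ • w = v ∧ g ∘ σ.symm = q then DivCat.wordT k q else 0)
    (U : DivCat k d) : diagRel (Ω × Ω') U ≤ D.pairSpan R U := by
  refine Submodule.span_le.2 ?_
  rintro _ ⟨i, j, ⟨w, w'⟩, u, hij, hw, hu, rfl⟩
  have hw₁ : Equiv.swap i j • w = w := congrArg Prod.fst hw
  have hw₂ : Equiv.swap i j • w' = w' := congrArg Prod.snd hw
  have hg : ∀ p, u (collapse i j p) = u p := fun p => by
    rcases eq_or_ne p j with rfl | hp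
    · rw [collapse, Function.update_self, hu]
    · rw [collapse, Function.update_of_ne hp, id]
  have hgij : collapse i j i = collapse i j j := by
    rw [collapse, Function.update_self, Function.update_of_ne hij, id]
  obtain ⟨x, hx⟩ := hD w (collapse i j)
  obtain ⟨ψ, hψ⟩ := DivCat.exists_tact_wordT (k := k) (U := U) (collapse i j) u hg
  have hc : ∀ v, DivCat.tact (DivCat.mulHom k d ≫ ψ) (DivCat.tmul (D.coeff _ v x)
      (DivCat.wordT k (collapse i j))) = if w = v then PiTensorProduct.tprod k u else 0 := by
    intro v
    rw [hx, map_sum, LinearMap.sum_apply, map_sum, Finset.sum_eq_single (collapse i j)]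
    · by_cases hv : w = v
      · rw [if_pos ⟨1, by rw [one_smul, hv], rfl⟩, if_pos hv, DivCat.tact_comp,
          DivCat.tact_mulHom_wordT, if_pos rfl, hψ]
      · rw [if_neg hv, if_neg, map_zero, LinearMap.zero_apply, map_zero]
        rintro ⟨σ, hσ, hσg⟩
        rcases swap_of_collapse_comp hij hσg with rfl | rfl
        · exact hv (by rw [← hσ, one_smul])
        · exact hv (by rw [← hσ, hw₁])
    · intro q _ hq
      split_ifs
      · rw [DivCat.tact_comp, DivCat.tact_mulHom_wordT, if_neg hq, map_zero]
      · rw [map_zero, LinearMap.zero_apply, map_zero]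
    · simp
  refine Submodule.subset_span ⟨_, _, DivCat.mulHom k d ≫ ψ, x, Pi.single w'
    (DivCat.wordT k (collapse i j)), hR _ (Submodule.subset_span
      ⟨i, j, w', _, hij, hw₂, by rw [hgij], rfl⟩), ?_⟩
  rw [D.pair_single, map_sum]
  simp only [actPi_single, hc]
  rw [Finset.sum_eq_single w]
  · rw [if_pos rfl]
  · intro v _ hv
    rw [if_neg hv.symm, Pi.single_zero]
  · simp

end Coefficients

end SPF

end

end StrictPoly

namespace StrictPoly

noncomputable section

/-! ## Words of a given weight -/

section Words

variable {n m d : ℕ}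

/-- The words of length `d` in which the letter `i` occurs `l i` times. -/
def Words (l : Weight n d) : Type :=
  {w : Fin d → Fin n // ∀ i, (Finset.univ.filter fun p => w p = i).card = l.1 i}

instance (l : Weight n d) : Fintype (Words l) := inferInstanceAs (Fintype (Subtype _))

instance (l : Weight n d) : DecidableEq (Words l) := inferInstanceAs (DecidableEq (Subtype _))

instance (l : Weight n d) : MulAction (Equiv.Perm (Fin d)) (Words l) where
  smul σ w := ⟨w.1 ∘ σ.symm, fun i => by
    rw [← w.2 i]
    exact Finset.card_equiv σ.symm (by simp)⟩
  one_smul _ := rfl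
  mul_smul _ _ _ := rfl

lemma Words.smul_val {l : Weight n d} (σ : Equiv.Perm (Fin d)) (w : Words l) :
    (σ • w).1 = w.1 ∘ σ.symm := rfl

lemma Words.apply_eq_of_swap_smul {l : Weight n d} {w : Words l} {i j : Fin d}
    (h : Equiv.swap i j • w = w) : w.1 i = w.1 j := by
  have := congrFun (congrArg Subtype.val h) j
  rw [Words.smul_val, Function.comp_apply, Equiv.symm_swap, Equiv.swap_apply_right] at this
  exact this

/-- The word of the blocks of a weight. -/
def blockWord (l : Weight n d) : Words l := ⟨l.block, fun i => by
  rw [← Fintype.card_subtype]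
  have e : {j : Fin d // l.block j = i} ≃ {s : Σ i, Fin (l.1 i) // s.1 = i} :=
    ((finCongr l.2.symm).trans finSigmaFinEquiv.symm).subtypeEquiv fun _ => Iff.rfl
  rw [Fintype.card_congr (e.trans (Equiv.sigmaSubtype i)), Fintype.card_fin]⟩

/-- Two words of the same weight have letter fibres of equal size, and bijections between the fibres
assemble to a permutation. -/
lemma exists_smul_blockWord {l : Weight n d} (w : Words l) :
    ∃ σ : Equiv.Perm (Fin d), σ • blockWord l = w := by
  have h : ∀ i, Nonempty ({p // l.block p = i} ≃ {p // w.1 p = i}) := fun i =>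
    Fintype.card_eq.1 (by
      rw [Fintype.card_subtype, Fintype.card_subtype, w.2 i, ← (blockWord l).2 i]
      rfl)
  refine ⟨Equiv.ofFiberEquiv fun i => (h i).some, Subtype.ext (funext fun p => ?_)⟩
  rw [Words.smul_val, Function.comp_apply]
  conv_rhs => rw [← Equiv.apply_symm_apply (Equiv.ofFiberEquiv fun i => (h i).some) p]
  exact (Equiv.ofFiberEquiv_map _ _).symm

/-- Together with transitivity, this identifies words with cosets of the Young subgroup. -/
lemma smul_blockWord {l : Weight n d} {σ : Equiv.Perm (Fin d)} :
    σ • blockWord l = blockWord l ↔ σ ∈ l.young := by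
  constructor
  · intro h j
    have := congrFun (congrArg Subtype.val h) (σ j)
    rw [Words.smul_val, Function.comp_apply, Equiv.symm_apply_apply] at this
    exact this.symm
  · intro h
    refine Subtype.ext (funext fun p => ?_)
    have := h (σ.symm p)
    rw [Equiv.apply_symm_apply] at this
    exact this.symm

lemma swap_smul_blockWord {l : Weight n d} {i j : Fin d} (h : l.block i = l.block j) :
    Equiv.swap i j • blockWord l = blockWord l := by
  rw [smul_blockWord]
  intro p
  rcases eq_or_ne p i with rfl | hi
  · rw [Equiv.swap_apply_left, h]
  · rcases eq_or_ne p j with rfl | hj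
    · rw [Equiv.swap_apply_right, h]
    · rw [Equiv.swap_apply_of_ne_of_ne hi hj]

/-- A permutation that takes the word of the blocks to a given word. -/
def toWord {l : Weight n d} (w : Words l) : Equiv.Perm (Fin d) :=
  (exists_smul_blockWord w).choose

@[simp] lemma toWord_smul {l : Weight n d} (w : Words l) : toWord w • blockWord l = w :=
  (exists_smul_blockWord w).choose_spec

/-- The two words of the rows and columns of a word in the entries of a matrix. -/
def splitWord (c : Weight m d) (r : Weight n d)
    (v : Σ A : Weight.Matrices r c, Words (Weight.ofMatrix A)) : Words c × Words r :=
  (⟨fun p => (finProdFinEquiv.symm (v.2.1 p)).2, fun j => by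
      rw [← v.1.2.2 j, Finset.card_eq_sum_card_fiberwise
        (f := fun p => (finProdFinEquiv.symm (v.2.1 p)).1) (t := Finset.univ)
          fun _ _ => Finset.mem_univ _]
      refine Finset.sum_congr rfl fun i _ => ?_
      have h := v.2.2 (finProdFinEquiv (i, j))
      simp only [Weight.ofMatrix, Equiv.symm_apply_apply] at h
      rw [← h, Finset.filter_filter]
      congr 1
      ext p
      simp only [Finset.mem_filter, Finset.mem_univ, true_and, ← Equiv.symm_apply_eq,
        Prod.ext_iff, and_comm]⟩,
   ⟨fun p => (finProdFinEquiv.symm (v.2.1 p)).1, fun i => by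
      rw [← v.1.2.1 i, Finset.card_eq_sum_card_fiberwise
        (f := fun p => (finProdFinEquiv.symm (v.2.1 p)).2) (t := Finset.univ)
          fun _ _ => Finset.mem_univ _]
      refine Finset.sum_congr rfl fun j _ => ?_
      have h := v.2.2 (finProdFinEquiv (i, j))
      simp only [Weight.ofMatrix, Equiv.symm_apply_apply] at h
      rw [← h, Finset.filter_filter]
      congr 1
      ext p
      simp only [Finset.mem_filter, Finset.mem_univ, true_and, ← Equiv.symm_apply_eq,
        Prod.ext_iff]⟩)

lemma splitWord_smul (c : Weight m d) (r : Weight n d) (σ : Equiv.Perm (Fin d))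
    (A : Weight.Matrices r c) (v : Words (Weight.ofMatrix A)) :
    splitWord c r ⟨A, σ • v⟩ = σ • splitWord c r ⟨A, v⟩ := rfl

/-- The entry (i, j) of the matrix has to be the number of places with row letter i and column
letter j. So the matrix is determined by the pair of words, and these numbers have the required row
and column sums. -/
lemma splitWord_bijective (c : Weight m d) (r : Weight n d) :
    Function.Bijective (splitWord c r) := by
  constructor
  · rintro ⟨A, v⟩ ⟨B, w⟩ h
    have h₁ : ∀ p, (finProdFinEquiv.symm (v.1 p)).2 = (finProdFinEquiv.symm (w.1 p)).2 :=
      congrFun (congrArg Subtype.val (congrArg Prod.fst h))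
    have h₂ : ∀ p, (finProdFinEquiv.symm (v.1 p)).1 = (finProdFinEquiv.symm (w.1 p)).1 :=
      congrFun (congrArg Subtype.val (congrArg Prod.snd h))
    have hvw : v.1 = w.1 := funext fun p =>
      finProdFinEquiv.symm.injective (Prod.ext (h₂ p) (h₁ p))
    have hAB : A = B := by
      refine Subtype.ext (Matrix.ext fun i j => ?_)
      have hv := v.2 (finProdFinEquiv (i, j))
      have hw := w.2 (finProdFinEquiv (i, j))
      simp only [Weight.ofMatrix, Equiv.symm_apply_apply] at hv hw
      rw [← hv, ← hw, hvw]
    subst hAB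
    rw [show v = w from Subtype.ext hvw]
  · rintro ⟨w, w'⟩
    let A : Weight.Matrices r c :=
      ⟨fun i j => (Finset.univ.filter fun p => finProdFinEquiv (w'.1 p, w.1 p) =
        finProdFinEquiv (i, j)).card, fun i => by
          rw [← w'.2 i, Finset.card_eq_sum_card_fiberwise (f := w.1) (t := Finset.univ)
            fun _ _ => Finset.mem_univ _]
          refine Finset.sum_congr rfl fun j _ => ?_
          rw [Finset.filter_filter]
          simp only [EmbeddingLike.apply_eq_iff_eq, Prod.mk.injEq], fun j => by
          rw [← w.2 j, Finset.card_eq_sum_card_fiberwise (f := w'.1) (t := Finset.univ)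
            fun _ _ => Finset.mem_univ _]
          refine Finset.sum_congr rfl fun i _ => ?_
          rw [Finset.filter_filter]
          simp only [EmbeddingLike.apply_eq_iff_eq, Prod.mk.injEq, and_comm]⟩
    refine ⟨⟨A, ⟨fun p => finProdFinEquiv (w'.1 p, w.1 p), fun i => ?_⟩⟩, ?_⟩
    · obtain ⟨⟨a, b⟩, rfl⟩ := finProdFinEquiv.surjective i
      simp only [Weight.ofMatrix, Equiv.symm_apply_apply, A]
    · refine Prod.ext (Subtype.ext (funext fun p => ?_)) (Subtype.ext (funext fun p => ?_))
      · simp [splitWord]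
      · simp [splitWord]

/-- A pair of words is a word in the entries of a matrix with prescribed row and column sums. -/
def splitEquiv (c : Weight m d) (r : Weight n d) :
    (Σ A : Weight.Matrices r c, Words (Weight.ofMatrix A)) ≃ Words c × Words r :=
  Equiv.ofBijective _ (splitWord_bijective c r)

/-- Every matrix is reached from a pair of words, namely from the two words of its own block word.
-/
instance (c : Weight m d) (r : Weight n d) : Finite (Weight.Matrices r c) :=
  Finite.of_surjective (fun x : Words c × Words r => ((splitEquiv c r).symm x).1) fun A =>
    ⟨splitEquiv c r ⟨A, blockWord _⟩, congrArg Sigma.fst (Equiv.symm_apply_apply _ _)⟩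

end Words

end

end StrictPoly

namespace StrictPoly

noncomputable section

variable {k : Type u} [CommRing k] {d n m : ℕ}

namespace SPF

/-! ### Presentations of symmetric and exterior powers by words -/

section WordPresentation

variable (l : Weight n d) (ε : Equiv.Perm (Fin d) →* k)

/-- The map from `k[Ω] ⊗ V^{⊗ d}`, for the words `Ω` of weight `l`, to a quotient of `V^{⊗ d}`. -/
def wordProj {V : DivCat k d} (r : Submodule k V.T) : (Words l → V.T) →ₗ[k] V.T ⧸ r :=
  ∑ w : Words l, ε (toWord w) • (r.mkQ ∘ₗ perm k (toWord w)⁻¹ ∘ₗ LinearMap.proj w)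

variable {l ε} {V : DivCat k d} {r : Submodule k V.T}

/-- The choice made by `toWord` does not matter: two permutations that produce the same word differ
by an element of the Young subgroup, which acts on the quotient through `ε`. -/
lemma wordProj_single (hr : ∀ σ ∈ l.young, ∀ t : V.T, perm k σ t - ε σ • t ∈ r) {w : Words l}
    {σ : Equiv.Perm (Fin d)} (hσ : σ • blockWord l = w) (t : V.T) :
    wordProj l ε r (Pi.single w t) = ε σ • r.mkQ (perm k σ⁻¹ t) := by
  have h₁ : wordProj l ε r (Pi.single w t) =
      ε (toWord w) • r.mkQ (perm k (toWord w)⁻¹ t) := by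
    rw [wordProj, LinearMap.sum_apply, Finset.sum_eq_single w]
    · simp
    · intro v _ hv
      rw [LinearMap.smul_apply, LinearMap.comp_apply, LinearMap.comp_apply, LinearMap.proj_apply,
        Pi.single_eq_of_ne hv, map_zero, map_zero, smul_zero]
    · simp
  have hy : (toWord w)⁻¹ * σ ∈ l.young := by
    rw [← smul_blockWord, mul_smul, hσ, inv_smul_eq_iff, toWord_smul]
  have h := hr _ hy (perm k σ⁻¹ t)
  rw [← perm_mul, mul_inv_cancel_right, ← Submodule.Quotient.mk_eq_zero, ← Submodule.mkQ_apply,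
    map_sub, sub_eq_zero, map_smul] at h
  rw [h₁, h, smul_smul, ← map_mul, mul_inv_cancel_left]

lemma wordProj_charRel (hr : ∀ σ ∈ l.young, ∀ t : V.T, perm k σ t - ε σ • t ∈ r) :
    charRel (Words l) ε V ≤ LinearMap.ker (wordProj l ε r) := by
  refine Submodule.span_le.2 ?_
  rintro _ ⟨σ, w, t, rfl⟩
  rw [SetLike.mem_coe, LinearMap.mem_ker, map_sub, map_smul,
    wordProj_single hr (toWord_smul w),
    wordProj_single hr (σ := σ * toWord w) (by rw [mul_smul, toWord_smul]), smul_smul,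
    ← map_mul, mul_inv_rev, perm_mul, perm_inv_perm, sub_self]

/-- A functor that is a quotient of the tensor power is presented by words. -/
def wordPresentation {Y : SPF k d} (r : ∀ V : DivCat k d, Submodule k V.T)
    (e : ∀ V, (V.T ⧸ r V) ≃ₗ[k] Y.val V)
    (he : ∀ {V W : DivCat k d} (f : V ⟶ W) (t : V.T),
      Y.act f (e V ((r V).mkQ t)) = e W ((r W).mkQ (DivCat.tact f t)))
    (R : ∀ V : DivCat k d, Submodule k (Words l → V.T))
    (hr : ∀ V, ∀ σ ∈ l.young, ∀ t : V.T, perm k σ t - ε σ • t ∈ r V)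
    (hR : ∀ V, charRel (Words l) ε V ≤ R V)
    (hrR : ∀ V, r V ≤ (R V).comap (LinearMap.single k (fun _ => V.T) (blockWord l)))
    (hRr : ∀ V, R V ≤ LinearMap.ker (wordProj l ε (r V))) :
    Presentation Y (Words l) R where
  proj V := (e V).toLinearMap ∘ₗ wordProj l ε (r V)
  surjective V := by
    refine (e V).surjective.comp fun q => ?_
    obtain ⟨t, rfl⟩ := (r V).mkQ_surjective q
    refine ⟨Pi.single (blockWord l) t, ?_⟩
    rw [wordProj_single (hr V) (one_smul _ _), map_one, one_smul, inv_one, perm_one]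
  proj_eq_zero V z := by
    rw [LinearMap.comp_apply, LinearEquiv.coe_coe, LinearEquiv.map_eq_zero_iff]
    refine ⟨fun h => ?_, fun h => hRr V h⟩
    -- Modulo the character relations, every term is moved to the block word. The whole family
    -- becomes one tensor there, which lies in `r V` by assumption, and `hrR` puts it into `R V`.
    have h₁ : ∀ w, (R V).mkQ (Pi.single w (z w)) =
        (R V).mkQ (Pi.single (blockWord l) (ε (toWord w) • perm k (toWord w)⁻¹ (z w))) := by
      intro w
      have h := hR V (single_perm_sub_mem (toWord w) (blockWord l)
        (perm k (toWord w)⁻¹ (z w)))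
      rw [← perm_mul, mul_inv_cancel, perm_one, toWord_smul, ← Pi.single_smul,
        ← Submodule.Quotient.mk_eq_zero, ← Submodule.mkQ_apply, map_sub, sub_eq_zero] at h
      exact h
    have h₂ : ∑ w, ε (toWord w) • perm k (toWord w)⁻¹ (z w) ∈ r V := by
      rw [← Submodule.Quotient.mk_eq_zero, ← Submodule.mkQ_apply, ← h]
      simp [wordProj]
    have h₃ := hrR V h₂
    rw [Submodule.mem_comap, map_sum, ← Submodule.Quotient.mk_eq_zero, ← Submodule.mkQ_apply,
      map_sum] at h₃
    rw [← Submodule.Quotient.mk_eq_zero, ← Submodule.mkQ_apply, ← Finset.univ_sum_single z,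
      map_sum, ← h₃]
    exact Finset.sum_congr rfl fun w _ => h₁ w
  act_proj {V W} f z := by
    have key : Y.act f ∘ₗ (e V).toLinearMap ∘ₗ wordProj l ε (r V) =
        (e W).toLinearMap ∘ₗ wordProj l ε (r W) ∘ₗ actPi (Words l) f := by
      refine LinearMap.pi_ext fun w t => ?_
      simp only [LinearMap.comp_apply, LinearEquiv.coe_coe, actPi_single]
      rw [wordProj_single (hr V) (toWord_smul w), wordProj_single (hr W) (toWord_smul w),
        map_smul, map_smul, map_smul, he, DivCat.perm_tact]
    exact LinearMap.congr_fun key z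

end WordPresentation

/-- The presentation of `Sym^l` by words. -/
def symmPresentation (k : Type u) [CommRing k] (l : Weight n d) :
    Presentation (Symm k l) (Words l) (charRel (Words l) (1 : Equiv.Perm (Fin d) →* k)) :=
  have hr : ∀ V : DivCat k d, ∀ σ ∈ l.young, ∀ t : V.T,
      perm k σ t - (1 : Equiv.Perm (Fin d) →* k) σ • t ∈ symRel k l V.carrier :=
    fun V σ hσ t => by
      rw [MonoidHom.one_apply, one_smul]
      exact Submodule.subset_span ⟨σ, hσ, t, rfl⟩
  wordPresentation (ε := 1) (fun V => symRel k l V.carrier) (fun V => LinearEquiv.refl k _)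
    (fun _ _ => rfl) _ hr (fun _ => le_rfl)
    (fun V => Submodule.span_le.2 <| by
      rintro _ ⟨σ, hσ, s, rfl⟩
      have h := single_perm_sub_mem (ε := (1 : Equiv.Perm (Fin d) →* k)) σ (blockWord l) s
      rw [smul_blockWord.2 hσ, MonoidHom.one_apply, one_smul] at h
      rw [SetLike.mem_coe, Submodule.mem_comap, map_sub]
      exact h)
    (fun V => wordProj_charRel (hr V))

/-- The Young subgroup is generated by the exchanges of two places in one block. For such an
exchange the claim is the polarization of the alternating relation, `altPair_add_swap`, which needs
no division by 2. -/
lemma perm_sub_sgn_mem_altRel {l : Weight n d} {M : Type u} [AddCommGroup M] [Module k M]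
    {σ : Equiv.Perm (Fin d)} (hσ : σ ∈ l.young) (t : TPow k d M) :
    perm k σ t - sgnChar k d σ • t ∈ altRel k l M := by
  let S : Set (Equiv.Perm (Fin d)) := {τ | ∃ i j, i ≠ j ∧ l.block i = l.block j ∧
    τ = Equiv.swap i j}
  have hS : σ ∈ Subgroup.closure S := by
    -- It suffices that each p and σ p lie in one orbit of the generated group. As σ preserves the
    -- blocks, the exchange of p and σ p is itself a generator.
    refine (mem_closure_isSwap ?_).2 ⟨Set.toFinite _, fun p => ?_⟩
    · rintro _ ⟨i, j, hij, -, rfl⟩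
      exact ⟨i, j, hij, rfl⟩
    · by_cases hp : p = σ p
      · rw [← hp]
        exact MulAction.mem_orbit_self p
      · exact ⟨⟨Equiv.swap p (σ p), Subgroup.subset_closure ⟨p, σ p, hp, (hσ p).symm, rfl⟩⟩,
          Equiv.swap_apply_left _ _⟩
  clear hσ
  induction hS using Subgroup.closure_induction generalizing t with
  | mem τ hτ =>
    obtain ⟨i, j, hij, hb, rfl⟩ := hτ
    rw [sgnChar_swap hij, neg_one_smul, sub_neg_eq_add]
    induction t using tpow_induction with
    | h x =>
      have hle : altPair k i j M ≤ altRel k l M := by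
        refine Submodule.span_le.2 ?_
        rintro _ ⟨y, hy, rfl⟩
        exact Submodule.subset_span ⟨i, j, y, hij, hb, hy, rfl⟩
      rw [add_comm, perm_tprod, Equiv.symm_swap]
      exact hle (altPair_add_swap hij x)
    | hs c t h =>
      rw [map_smul, ← smul_add]
      exact Submodule.smul_mem _ _ h
    | ha s t h₁ h₂ =>
      rw [map_add, add_add_add_comm]
      exact add_mem h₁ h₂
  | one => rw [perm_one, map_one, one_smul, sub_self]; exact zero_mem _
  | mul τ τ' _ _ h₁ h₂ =>
    have := add_mem (h₁ (perm k τ' t)) (Submodule.smul_mem _ (sgnChar k d τ) (h₂ t))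
    rwa [smul_sub, sub_add_sub_cancel, smul_smul, ← perm_mul, ← map_mul] at this
  | inv τ _ h =>
    have h' : sgnChar k d τ⁻¹ = sgnChar k d τ := by simp [sgnChar]
    have := Submodule.smul_mem _ (-sgnChar k d τ) (h (perm k τ⁻¹ t))
    rwa [← perm_mul, mul_inv_cancel, perm_one, smul_sub, neg_smul, neg_smul, smul_smul,
      sgnChar_sq, one_smul, sub_neg_eq_add, neg_add_eq_sub, ← h'] at this

/-- The presentation of `∧^l` by words. -/
def wedgePresentation (k : Type u) [CommRing k] (l : Weight n d) :
    Presentation (Wedge k l) (Words l) (extRel (k := k) (Words l)) :=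
  have hr : ∀ V : DivCat k d, ∀ σ ∈ l.young, ∀ t : V.T,
      perm k σ t - sgnChar k d σ • t ∈ altRel k l V.carrier :=
    fun V σ hσ t => perm_sub_sgn_mem_altRel hσ t
  wordPresentation (ε := sgnChar k d) (fun V => altRel k l V.carrier)
    (fun V => LinearEquiv.refl k _) (fun _ _ => rfl) _ hr (fun _ => le_sup_left)
    (fun V => Submodule.span_le.2 <| by
      rintro _ ⟨i, j, x, hij, hb, hx, rfl⟩
      exact Submodule.mem_sup_right
        (Submodule.subset_span ⟨i, j, _, x, hij, swap_smul_blockWord hb, hx, rfl⟩))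
    (fun V => sup_le (wordProj_charRel (hr V)) <| Submodule.span_le.2 <| by
      rintro _ ⟨i, j, w, x, hij, hw, hx, rfl⟩
      rw [SetLike.mem_coe, LinearMap.mem_ker, wordProj_single (hr V) (toWord_smul w),
        perm_tprod]
      have hb : l.block ((toWord w)⁻¹ i) = l.block ((toWord w)⁻¹ j) := by
        have h := Words.apply_eq_of_swap_smul hw
        rw [← toWord_smul w] at h
        exact h
      have hmem : PiTensorProduct.tprod k (fun p => x ((toWord w)⁻¹.symm p)) ∈
          altRel k l V.carrier :=
        Submodule.subset_span ⟨(toWord w)⁻¹ i, (toWord w)⁻¹ j, _,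
          fun h => hij ((toWord w)⁻¹.injective h), hb, by
            rwa [Equiv.symm_apply_apply, Equiv.symm_apply_apply], rfl⟩
      rw [Submodule.mkQ_apply, (Submodule.Quotient.mk_eq_zero _).2 hmem, smul_zero])

/-! ### Coefficients of divided powers -/

section Gam

variable (l : Weight n d)

/-- Two permutations with the same effect on the block word differ by an element of the Young
subgroup, which fixes the tensor. So the coefficients of Γ^l do not depend on the choice of
`toWord`. -/
lemma perm_eq_of_smul_blockWord {l : Weight n d} {M : Type u} [AddCommGroup M] [Module k M]
    {t : TPow k d M} (ht : t ∈ invariants k l.young M) {σ τ : Equiv.Perm (Fin d)}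
    (h : σ • blockWord l = τ • blockWord l) : perm k σ t = perm k τ t := by
  have hy : τ⁻¹ * σ ∈ l.young := by
    rw [← smul_blockWord, mul_smul, h, inv_smul_smul]
  rw [← mul_inv_cancel_left τ σ, perm_mul, ht _ hy]

/-- The sum of the words over the permutations that take `w` to the word of the blocks. -/
def gamBase (k : Type u) [CommRing k] {l : Weight n d} (w : Words l) :
    invariants k l.young (DivCat.free k d d).carrier :=
  ⟨∑ σ : Equiv.Perm (Fin d), if σ • w = blockWord l then perm k σ (DivCat.std k d) else 0,
    fun τ hτ => by
      rw [map_sum]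
      refine Fintype.sum_equiv (Equiv.mulLeft τ) _ _ fun σ => ?_
      have h : (τ * σ) • w = blockWord l ↔ σ • w = blockWord l := by
        rw [mul_smul, smul_eq_iff_eq_inv_smul, smul_blockWord.2 (inv_mem hτ)]
      rw [Equiv.coe_mulLeft, apply_ite (perm k τ), map_zero, ← perm_mul]
      simp only [h]⟩

/-- The coefficients of `Γ^l`. -/
def gamCoefficients (k : Type u) [CommRing k] (l : Weight n d) :
    Coefficients (Gam k l) (Words l) 1 where
  coeff V w := perm k (toWord w) ∘ₗ (invariants k l.young V.carrier).subtype
  base w := gamBase k w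
  coeff_act f w x := DivCat.perm_tact f _ _ |>.trans rfl
  coeff_smul V σ w x := by
    change perm k (toWord (σ • w)) x.1 = (1 : k) • perm k σ (perm k (toWord w) x.1)
    rw [one_smul, ← perm_mul]
    exact perm_eq_of_smul_blockWord x.2 (by rw [toWord_smul, mul_smul, toWord_smul])
  coeff_base v w := by
    change perm k (toWord v) (∑ σ : Equiv.Perm (Fin d), if σ • w = blockWord l then
      perm k σ (DivCat.std k d) else 0) = _
    rw [map_sum]
    refine Fintype.sum_equiv (Equiv.mulLeft (toWord v)) _ _ fun σ => ?_
    have h : (toWord v * σ) • w = v ↔ σ • w = blockWord l := by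
      rw [mul_smul]
      exact ⟨fun h => smul_left_cancel (toWord v) (h.trans (toWord_smul v).symm),
        fun h => by rw [h, toWord_smul]⟩
    rw [Equiv.coe_mulLeft, apply_ite (perm k (toWord v)), map_zero, ← perm_mul,
      MonoidHom.one_apply, one_smul]
    simp only [h]
  act_inclHom V x := by
    refine Subtype.ext ?_
    have h₁ : ((Gam k l).act V.inclHom x).1 = DivCat.tact V.inclHom x.1 := rfl
    have h₂ : (∑ w, (Gam k l).act (DivCat.extHom (DivCat.tmul (perm k (toWord w) x.1)
        (DivCat.std k d))) (gamBase k w)).1 = ∑ w : Words l, DivCat.tact (DivCat.extHom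
          (DivCat.tmul (perm k (toWord w) x.1) (DivCat.std k d))) (gamBase k w).1 :=
      map_sum (invariants k l.young (V.tensor (DivCat.free k d d)).carrier).subtype _ _
    refine h₁.trans (Eq.trans ?_ h₂.symm)
    rw [DivCat.tact_inclHom]
    simp only [gamBase, map_sum]
    rw [Finset.sum_comm]
    refine Finset.sum_congr rfl fun σ _ => ?_
    -- For each σ only one word contributes, and there σ undoes the permutation in the coefficient
    -- up to the Young subgroup, which leaves `x` itself.
    rw [Finset.sum_eq_single (σ⁻¹ • blockWord l)]
    · rw [smul_inv_smul, if_pos rfl, DivCat.tact_extHom_perm, DivCat.perm_tmul, ← perm_mul]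
      congr 2
      have h := perm_eq_of_smul_blockWord (k := k) x.2
        (σ := σ * toWord (σ⁻¹ • blockWord l)) (τ := 1)
        (by rw [mul_smul, toWord_smul, smul_inv_smul, one_smul])
      rw [h, perm_one]
    · intro w _ hw
      rw [if_neg, map_zero]
      rintro h
      exact hw (by rw [← h, inv_smul_smul])
    · simp

open scoped Classical in
-- The orbit sums are equivariant in the index `v`, so the one at the block word is invariant under
-- the Young subgroup and determines the others. It need not be a sum of all permutations of one
-- tensor, and this is what Γ has over Sym. The lemma supplies the hypothesis `hD` of
-- `diagRel_le_pairSpan`.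
lemma gamCoefficients_exists_word (w : Words l) (g : Fin d → Fin d) :
    ∃ x : (Gam k l).val (DivCat.free k d d), ∀ v,
      (gamCoefficients k l).coeff _ v x = ∑ q : Fin d → Fin d,
        if ∃ σ : Equiv.Perm (Fin d), σ • w = v ∧ g ∘ σ.symm = q then DivCat.wordT k q else 0 := by
  let s : Words l → (DivCat.free k d d).T := fun v => ∑ q : Fin d → Fin d,
    if ∃ σ : Equiv.Perm (Fin d), σ • w = v ∧ g ∘ σ.symm = q then DivCat.wordT k q else 0
  have hs : ∀ (τ : Equiv.Perm (Fin d)) (v : Words l), perm k τ (s v) = s (τ • v) := by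
    intro τ v
    rw [map_sum]
    refine Fintype.sum_equiv (τ.arrowCongr (Equiv.refl _)) _ _ fun q => ?_
    rw [apply_ite (perm k τ), map_zero, DivCat.perm_wordT]
    refine if_congr ⟨?_, ?_⟩ rfl rfl
    · rintro ⟨σ, rfl, rfl⟩
      exact ⟨τ * σ, mul_smul _ _ _, rfl⟩
    · rintro ⟨σ, hσ, hq⟩
      refine ⟨τ⁻¹ * σ, by rw [mul_smul, hσ, inv_smul_smul], ?_⟩
      ext p
      have h : g (σ.symm (τ p)) = q (τ.symm (τ p)) := congrFun hq (τ p)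
      rw [Equiv.symm_apply_apply] at h
      exact congrArg Fin.val h
  refine ⟨⟨s (blockWord l), fun τ hτ => by rw [hs, smul_blockWord.2 hτ]⟩, fun v => ?_⟩
  change perm k (toWord v) (s (blockWord l)) = s v
  rw [hs, toWord_smul]

end Gam

end SPF

end

end StrictPoly

namespace StrictPoly

noncomputable section

variable {k : Type u} [CommRing k] {d n m : ℕ}

namespace SPF

/-! ### Presentations of direct sums -/

section Sum

variable {ι : Type} {Ω : Type} {Ωs : ι → Type} (e : (Σ i, Ωs i) ≃ Ω)

/-- The part of an element of `k[Ω] ⊗ V^{⊗ d}` in one summand of `Ω`. -/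
abbrev restrict (V : DivCat k d) (i : ι) : (Ω → V.T) →ₗ[k] (Ωs i → V.T) :=
  LinearMap.funLeft k V.T fun v => e ⟨i, v⟩

section

variable [Fintype ι] {Y : ι → SPF k d} {Rs : ∀ (i : ι) (V : DivCat k d), Submodule k (Ωs i → V.T)}
  (P : ∀ i, Presentation (Y i) (Ωs i) (Rs i))

/-- The quotient map onto a direct sum of presented functors. -/
def sumProj (V : DivCat k d) : (Ω → V.T) →ₗ[k] DirectSum ι fun i => (Y i).val V :=
  (DirectSum.linearEquivFunOnFintype k ι fun i => (Y i).val V).symm.toLinearMap ∘ₗ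
    LinearMap.pi fun i => (P i).proj V ∘ₗ restrict e V i

lemma sumProj_apply (V : DivCat k d) (z : Ω → V.T) (i : ι) :
    sumProj e P V z i = (P i).proj V (restrict e V i z) :=
  congrFun ((DirectSum.linearEquivFunOnFintype k ι fun i => (Y i).val V).apply_symm_apply
    (LinearMap.pi (fun i => (P i).proj V ∘ₗ restrict e V i) z)) i

lemma sumProj_surjective (V : DivCat k d) : Function.Surjective (sumProj e P V) := fun y => by
  choose z hz using fun i => (P i).surjective V (y i)
  refine ⟨fun w => z (e.symm w).1 (e.symm w).2, DFinsupp.ext fun i => ?_⟩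
  refine (sumProj_apply e P V _ i).trans ?_
  rw [← hz i]
  refine congrArg ((P i).proj V) (funext fun v => ?_)
  change z (e.symm (e ⟨i, v⟩)).1 (e.symm (e ⟨i, v⟩)).2 = z i v
  rw [Equiv.symm_apply_apply]

lemma sumProj_eq_zero (V : DivCat k d) (z : Ω → V.T) :
    sumProj e P V z = 0 ↔ ∀ i, restrict e V i z ∈ Rs i V := by
  refine (DFinsupp.ext_iff (f := sumProj e P V z) (g := 0)).trans (forall_congr' fun i => ?_)
  rw [← (P i).proj_eq_zero V, ← sumProj_apply e P V z i]
  rfl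

lemma lmap_act_sumProj {V W : DivCat k d} (f : V ⟶ W) (z : Ω → V.T) :
    DirectSum.lmap (fun i => (Y i).actₗ f) (sumProj e P V z) = sumProj e P W (actPi Ω f z) := by
  refine DFinsupp.ext fun i => ?_
  refine Eq.trans ?_ (sumProj_apply e P W _ i).symm
  refine Eq.trans (congrArg ((Y i).act f) (sumProj_apply e P V z i)) ?_
  exact (P i).act_proj f _

/-- A direct sum of presented functors is presented by the disjoint union. -/
def sumPresentation (R : ∀ V : DivCat k d, Submodule k (Ω → V.T))
    (hR : ∀ V z, z ∈ R V ↔ ∀ i, restrict e V i z ∈ Rs i V) :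
    Presentation (directSum Y) Ω R where
  proj V := sumProj e P V
  surjective V := sumProj_surjective e P V
  proj_eq_zero V z := (sumProj_eq_zero e P V z).trans (hR V z).symm
  act_proj f z := lmap_act_sumProj e P f z

end

variable [∀ i, Fintype (Ωs i)] [DecidableEq Ω] [∀ i, DecidableEq (Ωs i)]

omit [∀ i, Fintype (Ωs i)] in
lemma restrict_single_same (V : DivCat k d) (i : ι) (v : Ωs i) (t : V.T) :
    restrict e V i (Pi.single (e ⟨i, v⟩) t) = Pi.single v t := by
  ext v' : 1
  change (Pi.single (e ⟨i, v⟩) t : Ω → V.T) (e ⟨i, v'⟩) = _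
  rcases eq_or_ne v' v with rfl | h
  · rw [Pi.single_eq_same, Pi.single_eq_same]
  · rw [Pi.single_eq_of_ne h, Pi.single_eq_of_ne]
    exact fun h' => h (by simpa using h')

omit [∀ i, Fintype (Ωs i)] [∀ i, DecidableEq (Ωs i)] in
lemma restrict_single_of_ne (V : DivCat k d) {i j : ι} (hij : i ≠ j) (v : Ωs i) (t : V.T) :
    restrict e V j (Pi.single (e ⟨i, v⟩) t) = 0 := by
  ext v' : 1
  change (Pi.single (e ⟨i, v⟩) t : Ω → V.T) (e ⟨j, v'⟩) = _
  rw [Pi.single_eq_of_ne, Pi.zero_apply]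
  exact fun h' => hij (congrArg Sigma.fst (e.injective h')).symm

/-- The extension by zero from one summand of `Ω`. -/
def extend (V : DivCat k d) (i : ι) : (Ωs i → V.T) →ₗ[k] (Ω → V.T) :=
  ∑ v, LinearMap.single k (fun _ => V.T) (e ⟨i, v⟩) ∘ₗ LinearMap.proj v

omit [∀ i, DecidableEq (Ωs i)] in
lemma extend_apply (V : DivCat k d) (i : ι) (y : Ωs i → V.T) :
    extend e V i y = ∑ v, Pi.single (e ⟨i, v⟩) (y v) := by
  simp [extend]

lemma extend_single (V : DivCat k d) (i : ι) (v : Ωs i) (t : V.T) :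
    extend e V i (Pi.single v t) = Pi.single (e ⟨i, v⟩) t := by
  rw [extend_apply, Finset.sum_eq_single v]
  · rw [Pi.single_eq_same]
  · intro v' _ hv
    rw [Pi.single_eq_of_ne hv, Pi.single_zero]
  · simp

omit [∀ i, DecidableEq (Ωs i)] in
-- A family is the sum of the extensions by zero of its restrictions, so compatibility of the
-- relations with both operations suffices.
lemma mem_iff_restrict_mem [Fintype ι] [Fintype Ω] {V : DivCat k d} {R : Submodule k (Ω → V.T)}
    {Rs : ∀ i, Submodule k (Ωs i → V.T)} (h₁ : ∀ i, R ≤ (Rs i).comap (restrict e V i))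
    (h₂ : ∀ i, Rs i ≤ R.comap (extend e V i)) (z : Ω → V.T) :
    z ∈ R ↔ ∀ i, restrict e V i z ∈ Rs i := by
  refine ⟨fun hz i => h₁ i hz, fun hz => ?_⟩
  have h : z = ∑ i, extend e V i (restrict e V i z) := by
    conv_lhs => rw [← Finset.univ_sum_single z, ← e.sum_comp, Fintype.sum_sigma]
    exact Finset.sum_congr rfl fun i _ => (extend_apply e V i _).symm
  rw [h]
  exact Submodule.sum_mem _ fun i _ => h₂ i (hz i)

variable [MulAction (Equiv.Perm (Fin d)) Ω] [∀ i, MulAction (Equiv.Perm (Fin d)) (Ωs i)]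
  (he : ∀ (σ : Equiv.Perm (Fin d)) (i : ι) (v : Ωs i), e ⟨i, σ • v⟩ = σ • e ⟨i, v⟩)
  (ε : Equiv.Perm (Fin d) →* k)

include he

omit [∀ i, Fintype (Ωs i)] in
-- By `he` the group preserves each summand, so both terms of a relation lie in the same one.
lemma charRel_le_restrict (V : DivCat k d) (i : ι) :
    charRel Ω ε V ≤ (charRel (Ωs i) ε V).comap (restrict e V i) := by
  refine Submodule.span_le.2 ?_
  rintro _ ⟨σ, w, t, rfl⟩
  obtain ⟨⟨j, v⟩, rfl⟩ := e.surjective w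
  rw [SetLike.mem_coe, Submodule.mem_comap, ← he, map_sub, map_smul]
  by_cases hij : j = i
  · subst hij
    rw [restrict_single_same, restrict_single_same]
    exact single_perm_sub_mem _ _ _
  · rw [restrict_single_of_ne e V hij, restrict_single_of_ne e V hij, smul_zero, sub_zero]
    exact zero_mem _

lemma charRel_le_extend (V : DivCat k d) (i : ι) :
    charRel (Ωs i) ε V ≤ (charRel Ω ε V).comap (extend e V i) := by
  refine Submodule.span_le.2 ?_
  rintro _ ⟨σ, v, t, rfl⟩
  rw [SetLike.mem_coe, Submodule.mem_comap, map_sub, map_smul, extend_single, extend_single, he]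
  exact single_perm_sub_mem _ _ _

omit [∀ i, Fintype (Ωs i)] in
lemma diagRel_le_restrict (V : DivCat k d) (i : ι) :
    diagRel Ω V ≤ (diagRel (Ωs i) V).comap (restrict e V i) := by
  refine Submodule.span_le.2 ?_
  rintro _ ⟨a, b, w, x, hab, hw, hx, rfl⟩
  obtain ⟨⟨j, v⟩, rfl⟩ := e.surjective w
  rw [SetLike.mem_coe, Submodule.mem_comap]
  by_cases hij : j = i
  · subst hij
    rw [← he] at hw
    rw [restrict_single_same]
    exact Submodule.subset_span ⟨a, b, v, x, hab, by simpa using hw, hx, rfl⟩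
  · rw [restrict_single_of_ne e V hij]
    exact zero_mem _

lemma diagRel_le_extend (V : DivCat k d) (i : ι) :
    diagRel (Ωs i) V ≤ (diagRel Ω V).comap (extend e V i) := by
  refine Submodule.span_le.2 ?_
  rintro _ ⟨a, b, v, x, hab, hv, hx, rfl⟩
  rw [SetLike.mem_coe, Submodule.mem_comap, extend_single]
  exact Submodule.subset_span ⟨a, b, _, x, hab, by rw [← he, hv], hx, rfl⟩

lemma mem_charRel_iff [Fintype ι] [Fintype Ω] (V : DivCat k d) (z : Ω → V.T) :
    z ∈ charRel Ω ε V ↔ ∀ i, restrict e V i z ∈ charRel (Ωs i) ε V :=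
  mem_iff_restrict_mem e (charRel_le_restrict e he ε V) (charRel_le_extend e he ε V) z

lemma mem_extRel_iff [Fintype ι] [Fintype Ω] (V : DivCat k d) (z : Ω → V.T) :
    z ∈ extRel Ω V ↔ ∀ i, restrict e V i z ∈ extRel (Ωs i) V :=
  mem_iff_restrict_mem e
    (fun i => sup_le ((charRel_le_restrict e he _ V i).trans (Submodule.comap_mono le_sup_left))
      ((diagRel_le_restrict e he V i).trans (Submodule.comap_mono le_sup_right)))
    (fun i => sup_le ((charRel_le_extend e he _ V i).trans (Submodule.comap_mono le_sup_left))
      ((diagRel_le_extend e he V i).trans (Submodule.comap_mono le_sup_right))) z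

end Sum

/-! ### The sign relation when 2 is a unit or zero -/

/-- For an exchange that fixes both the word and the tensor, the sign relation says that twice the
element is a relation, and 2 can be cancelled. -/
lemma extRel_le_charRel (h2 : IsUnit (2 : k)) (Ω : Type) [DecidableEq Ω]
    [MulAction (Equiv.Perm (Fin d)) Ω] (V : DivCat k d) :
    extRel Ω V ≤ charRel Ω (sgnChar k d) V := by
  refine sup_le le_rfl (Submodule.span_le.2 ?_)
  rintro _ ⟨i, j, w, x, hij, hw, hx, rfl⟩
  have h := single_perm_sub_mem (ε := sgnChar k d) (Equiv.swap i j) w (PiTensorProduct.tprod k x)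
  rw [hw, perm_swap_tprod hx, sgnChar_swap hij, neg_one_smul, sub_neg_eq_add, ← two_smul k] at h
  exact ((charRel Ω (sgnChar k d) V).smul_mem_iff_of_isUnit h2).1 h

lemma sgnChar_eq_one (h2 : (2 : k) = 0) : sgnChar k d = 1 := by
  have h : (-1 : k) = 1 := by
    rw [neg_eq_iff_add_eq_zero, one_add_one_eq_two, h2]
  refine MonoidHom.ext fun σ => ?_
  rcases Int.units_eq_one_or (Equiv.Perm.sign σ) with hσ | hσ <;> simp [sgnChar, hσ, h]

lemma sgnChar_mul_self : sgnChar k d * sgnChar k d = 1 := MonoidHom.ext sgnChar_sq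

/-! ### Internal tensor products -/

section Products

variable (lam : Weight m d) (mu : Weight n d)

instance : Fintype (Weight.Matrices mu lam) := Fintype.ofFinite _

/-- The presentation of a direct sum of symmetric powers by pairs of words. -/
def symmSumPresentation (k : Type u) [CommRing k] :
    Presentation (directSum fun nu : Weight.Matrices mu lam => Symm k (Weight.ofMatrix nu))
      (Words lam × Words mu) (charRel _ (1 : Equiv.Perm (Fin d) →* k)) :=
  sumPresentation (splitEquiv lam mu) (fun _ => symmPresentation k _) _
    (mem_charRel_iff (splitEquiv lam mu) (fun σ A v => splitWord_smul lam mu σ A v) 1)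

/-- The presentation of a direct sum of exterior powers by pairs of words. -/
def wedgeSumPresentation (k : Type u) [CommRing k] :
    Presentation (directSum fun nu : Weight.Matrices mu lam => Wedge k (Weight.ofMatrix nu))
      (Words lam × Words mu) (extRel (k := k) (d := d) _) :=
  sumPresentation (splitEquiv lam mu) (fun _ => wedgePresentation k _) _
    (mem_extRel_iff (splitEquiv lam mu) (fun σ A v => splitWord_smul lam mu σ A v))

/-- The coefficients of `Sym^l`. -/
def symmCoefficients (k : Type u) [CommRing k] (l : Weight n d) :
    Coefficients (Symm k l) (Words l) 1 :=
  Coefficients.ofPresentation (symmPresentation k l) (fun _ => one_mul _) (fun _ => le_rfl)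
    fun w _ _ hz => coeffSum_charRel (fun _ => one_mul _) w hz

lemma coeffSum_extRel (Ω : Type) [DecidableEq Ω] [MulAction (Equiv.Perm (Fin d)) Ω] (w : Ω)
    (V : DivCat k d) (z : Ω → V.T) (hz : z ∈ extRel Ω V) : coeffSum (sgnChar k d) w V z = 0 := by
  obtain ⟨a, ha, b, hb, rfl⟩ := Submodule.mem_sup.1 hz
  rw [map_add, coeffSum_charRel sgnChar_sq w ha, coeffSum_diagRel w hb, add_zero]

/-- The coefficients of `∧^l`. -/
def wedgeCoefficients (k : Type u) [CommRing k] (l : Weight n d) :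
    Coefficients (Wedge k l) (Words l) (sgnChar k d) :=
  Coefficients.ofPresentation (wedgePresentation k l) sgnChar_sq (fun _ => le_sup_left)
    (coeffSum_extRel _)

/-- Only here do the diagonal relations have to be matched in both directions over an arbitrary
ring. -/
lemma nonempty_gam_wedge : Nonempty (internalTensor (Gam k lam) (Wedge k mu) ≅
    directSum fun nu : Weight.Matrices mu lam => Wedge k (Weight.ofMatrix nu)) := by
  refine (gamCoefficients k lam).nonempty_iso (wedgePresentation k mu)
    (wedgeSumPresentation lam mu k) (fun V W x y hy => ?_) fun U => sup_le ?_ ?_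
  · obtain ⟨a, ha, b, hb, rfl⟩ := Submodule.mem_sup.1 hy
    rw [map_add]
    refine add_mem (Submodule.mem_sup_left ?_) ((gamCoefficients k lam).pair_mem_extRel x hb)
    have h := (gamCoefficients k lam).pair_mem_charRel (fun _ => one_mul _) x ha
    rwa [one_mul] at h
  · have h := (gamCoefficients k lam).charRel_le_pairSpan (fun _ => one_mul _)
      (R := extRel (Words mu)) (fun _ => le_sup_left) U
    rwa [one_mul] at h
  · exact (gamCoefficients k lam).diagRel_le_pairSpan (R := extRel (Words mu))
      (fun _ => le_sup_right) (gamCoefficients_exists_word lam) U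

lemma nonempty_gam_symm : Nonempty (internalTensor (Gam k lam) (Symm k mu) ≅
    directSum fun nu : Weight.Matrices mu lam => Symm k (Weight.ofMatrix nu)) := by
  refine (gamCoefficients k lam).nonempty_iso (symmPresentation k mu)
    (symmSumPresentation lam mu k) (fun V W x y hy => ?_) fun U => ?_
  · have h := (gamCoefficients k lam).pair_mem_charRel (fun _ => one_mul _) x hy
    rwa [one_mul] at h
  · have h := (gamCoefficients k lam).charRel_le_pairSpan (fun _ => one_mul _)
      (R := charRel (Words mu) 1) (fun _ => le_rfl) U
    rwa [one_mul] at h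

lemma nonempty_symm_symm : Nonempty (internalTensor (Symm k lam) (Symm k mu) ≅
    directSum fun nu : Weight.Matrices mu lam => Symm k (Weight.ofMatrix nu)) := by
  refine (symmCoefficients k lam).nonempty_iso (symmPresentation k mu)
    (symmSumPresentation lam mu k) (fun V W x y hy => ?_) fun U => ?_
  · have h := (symmCoefficients k lam).pair_mem_charRel (fun _ => one_mul _) x hy
    rwa [one_mul] at h
  · have h := (symmCoefficients k lam).charRel_le_pairSpan (fun _ => one_mul _)
      (R := charRel (Words mu) 1) (fun _ => le_rfl) U
    rwa [one_mul] at h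

/-- The two signs multiply to the trivial character, and the diagonal relations of the second factor
add nothing, so the relations are those of symmetric powers. -/
lemma nonempty_wedge_wedge : Nonempty (internalTensor (Wedge k lam) (Wedge k mu) ≅
    directSum fun nu : Weight.Matrices mu lam => Symm k (Weight.ofMatrix nu)) := by
  refine (wedgeCoefficients k lam).nonempty_iso (wedgePresentation k mu)
    (symmSumPresentation lam mu k) (fun V W x y hy => ?_) fun U => ?_
  · obtain ⟨a, ha, b, hb, rfl⟩ := Submodule.mem_sup.1 hy
    rw [map_add]
    have h₁ := (wedgeCoefficients k lam).pair_mem_charRel sgnChar_sq x ha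
    have h₂ := Coefficients.ofPresentation_pair_mem_charRel (wedgePresentation k lam) sgnChar_sq
      (fun _ => le_sup_left) (coeffSum_extRel _) x hb
    rw [sgnChar_mul_self] at h₁ h₂
    exact add_mem h₁ h₂
  · have h := (wedgeCoefficients k lam).charRel_le_pairSpan sgnChar_sq
      (R := extRel (Words mu)) (fun _ => le_sup_left) U
    rwa [sgnChar_mul_self] at h

lemma symmCoefficients_pair_mem {V W : DivCat k d} (x : (Symm k lam).val V) {y : Words mu → W.T}
    (hy : y ∈ extRel (Words mu) W) : (symmCoefficients k lam).pair (Words mu) V W x y ∈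
      charRel (Words lam × Words mu) (sgnChar k d) (V.tensor W) := by
  obtain ⟨a, ha, b, hb, rfl⟩ := Submodule.mem_sup.1 hy
  rw [map_add]
  have h₁ := (symmCoefficients k lam).pair_mem_charRel (fun _ => one_mul _) x ha
  have h₂ := Coefficients.ofPresentation_pair_mem_charRel (symmPresentation k lam)
    (fun _ => one_mul _) (fun _ => le_rfl)
    (fun w _ _ hz => coeffSum_charRel (fun _ => one_mul _) w hz) x hb
  rw [one_mul] at h₁ h₂
  exact add_mem h₁ h₂

/-- With `symmCoefficients_pair_mem`, the relations are exactly those of the sign character, over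
any ring. The two cases for 2 only differ in how these are recognized. -/
lemma charRel_le_symmCoefficients_pairSpan (U : DivCat k d) :
    charRel (Words lam × Words mu) (sgnChar k d) U ≤
      (symmCoefficients k lam).pairSpan (extRel (Words mu)) U := by
  have h := (symmCoefficients k lam).charRel_le_pairSpan (fun _ => one_mul _)
    (R := extRel (Words mu)) (fun _ => le_sup_left) U
  rwa [one_mul] at h

lemma nonempty_symm_wedge_of_isUnit (h2 : IsUnit (2 : k)) :
    Nonempty (internalTensor (Symm k lam) (Wedge k mu) ≅
      directSum fun nu : Weight.Matrices mu lam => Wedge k (Weight.ofMatrix nu)) :=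
  (symmCoefficients k lam).nonempty_iso (wedgePresentation k mu)
    (wedgeSumPresentation lam mu k)
    (fun _ _ x _ hy => Submodule.mem_sup_left (symmCoefficients_pair_mem lam mu x hy))
    fun U => (extRel_le_charRel h2 _ U).trans (charRel_le_symmCoefficients_pairSpan lam mu U)

lemma nonempty_symm_wedge_of_two_eq_zero (h2 : (2 : k) = 0) :
    Nonempty (internalTensor (Symm k lam) (Wedge k mu) ≅
      directSum fun nu : Weight.Matrices mu lam => Symm k (Weight.ofMatrix nu)) :=
  (symmCoefficients k lam).nonempty_iso (wedgePresentation k mu)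
    (symmSumPresentation lam mu k)
    (fun _ _ x _ hy => by
      have h := symmCoefficients_pair_mem lam mu x hy
      rwa [sgnChar_eq_one h2] at h)
    fun U => by
      have h := charRel_le_symmCoefficients_pairSpan (k := k) lam mu U
      rwa [sgnChar_eq_one h2] at h

end Products

end SPF

/-! ## Products of permutation modules -/

section PermModule

lemma exists_quotient_equiv {G Ω : Type} [Group G] [MulAction G Ω] (b : Ω) (H : Subgroup G)
    (hH : ∀ g : G, g • b = b ↔ g ∈ H) (hb : ∀ w : Ω, ∃ g : G, g • b = w) :
    ∃ e : G ⧸ H ≃ Ω, ∀ (g : G) (q : G ⧸ H), e (g • q) = g • e q := by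
  obtain rfl : MulAction.stabilizer G b = H := Subgroup.ext hH
  refine ⟨Equiv.ofBijective (MulAction.ofQuotientStabilizer G b)
    ⟨MulAction.injective_ofQuotientStabilizer G b, fun w => ?_⟩,
    MulAction.ofQuotientStabilizer_smul G b⟩
  obtain ⟨g, rfl⟩ := hb w
  exact ⟨g, rfl⟩

/-- The cosets of the Young subgroup are the words. -/
def quotientYoungEquiv (l : Weight n d) : Equiv.Perm (Fin d) ⧸ l.young ≃ Words l :=
  (exists_quotient_equiv (blockWord l) l.young (fun _ => smul_blockWord)
    exists_smul_blockWord).choose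

lemma quotientYoungEquiv_smul (l : Weight n d) (σ : Equiv.Perm (Fin d))
    (q : Equiv.Perm (Fin d) ⧸ l.young) :
    quotientYoungEquiv l (σ • q) = σ • quotientYoungEquiv l q :=
  (exists_quotient_equiv (blockWord l) l.young (fun _ => smul_blockWord)
    exists_smul_blockWord).choose_spec σ q

lemma quotientYoungEquiv_symm_smul (l : Weight n d) (σ : Equiv.Perm (Fin d)) (w : Words l) :
    (quotientYoungEquiv l).symm (σ • w) = σ • (quotientYoungEquiv l).symm w := by
  rw [Equiv.symm_apply_eq, quotientYoungEquiv_smul, Equiv.apply_symm_apply]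

/-- The basis of a permutation module that consists of the words. -/
def wordBasis (k : Type u) [CommRing k] (l : Weight n d) :
    Module.Basis (Words l) k (MonoidAlgebra k (Equiv.Perm (Fin d) ⧸ l.young)) :=
  (Module.Basis.ofRepr (MonoidAlgebra.coeffLinearEquiv k)).reindex (quotientYoungEquiv l)

lemma permModule_wordBasis (l : Weight n d) (σ : Equiv.Perm (Fin d)) (w : Words l) :
    permModule k l σ (wordBasis k l w) = wordBasis k l (σ • w) := by
  have h : ∀ w, wordBasis k l w = MonoidAlgebra.single ((quotientYoungEquiv l).symm w) 1 :=
    fun w => by simp [wordBasis]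
  rw [h, h, quotientYoungEquiv_symm_smul]
  simp [Representation.ofMulAction_single]

lemma dfinsuppBasis_apply {ι : Type*} [DecidableEq ι] {Z : ι → Type*} {M : ι → Type*}
    [∀ i, AddCommGroup (M i)] [∀ i, Module k (M i)] (b : ∀ i, Module.Basis (Z i) k (M i))
    (i : ι) (z : Z i) : DFinsupp.basis b ⟨i, z⟩ = DirectSum.lof k ι M i (b i z) := by
  refine (DFinsupp.basis b).repr.injective ?_
  rw [Module.Basis.repr_self]
  change _ = (sigmaFinsuppLequivDFinsupp k).symm
    (DFinsupp.mapRange (fun i => (b i).repr) (fun i => map_zero _) (DFinsupp.single i (b i z)))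
  rw [DFinsupp.mapRange_single, Module.Basis.repr_self, LinearEquiv.eq_symm_apply]
  exact sigmaFinsuppEquivDFinsupp_single _ _

/-- A tensor product of permutation representations decomposes as the product of the bases
does. -/
lemma nonempty_tprod_equiv_directSum {G ι X Y : Type*} [Group G] [DecidableEq ι] {Z : ι → Type*}
    [SMul G X] [SMul G Y] [∀ i, SMul G (Z i)] {A B : Type*} {M : ι → Type*}
    [AddCommGroup A] [Module k A] [AddCommGroup B] [Module k B]
    [∀ i, AddCommGroup (M i)] [∀ i, Module k (M i)]
    {ρ : Representation k G A} {τ : Representation k G B} {π : ∀ i, Representation k G (M i)}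
    (a : Module.Basis X k A) (b : Module.Basis Y k B) (c : ∀ i, Module.Basis (Z i) k (M i))
    (ha : ∀ g x, ρ g (a x) = a (g • x)) (hb : ∀ g y, τ g (b y) = b (g • y))
    (hc : ∀ i g z, π i g (c i z) = c i (g • z)) (e : X × Y ≃ Σ i, Z i)
    (he : ∀ (g : G) x, e (g • x) = ⟨(e x).1, g • (e x).2⟩) :
    Nonempty ((ρ.tprod τ).Equiv (Representation.directSum π)) := by
  have h : ∀ p : X × Y, (a.tensorProduct b).equiv (DFinsupp.basis c) e (a p.1 ⊗ₜ b p.2) =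
      DirectSum.lof k ι M (e p).1 (c _ (e p).2) := fun p => by
    rw [← Module.Basis.tensorProduct_apply, Module.Basis.equiv_apply]
    exact dfinsuppBasis_apply c _ _
  refine ⟨.mk ((a.tensorProduct b).equiv (DFinsupp.basis c) e) fun g => ?_⟩
  refine (a.tensorProduct b).ext fun p => ?_
  have h₁ : ρ.tprod τ g (a p.1 ⊗ₜ b p.2) = a (g • p).1 ⊗ₜ b (g • p).2 :=
    congrArg₂ (· ⊗ₜ[k] ·) (ha g p.1) (hb g p.2)
  have h₂ : Representation.directSum π g (DirectSum.lof k ι M (e p).1 (c _ (e p).2)) =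
      DirectSum.lof k ι M (e p).1 (c _ (g • (e p).2)) :=
    (DirectSum.lmap_lof ..).trans (congrArg _ (hc _ g _))
  rw [Module.Basis.tensorProduct_apply]
  refine (congrArg ((a.tensorProduct b).equiv (DFinsupp.basis c) e) h₁).trans ((h (g • p)).trans ?_)
  refine Eq.trans ?_ (congrArg (Representation.directSum π g) (h p)).symm
  rw [h₂, he]

lemma nonempty_permModule_tprod (lam : Weight m d) (mu : Weight n d) :
    Nonempty (((permModule k mu).tprod (permModule k lam)).Equiv
      (Representation.directSum fun nu : Weight.Matrices mu lam =>
        permModule k (Weight.ofMatrix nu))) := by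
  classical
  refine nonempty_tprod_equiv_directSum (wordBasis k mu) (wordBasis k lam)
    (fun nu => wordBasis k (Weight.ofMatrix nu)) (permModule_wordBasis mu)
    (permModule_wordBasis lam) (fun nu => permModule_wordBasis _)
    -- The factors are exchanged because `splitEquiv` puts the word of the columns, of weight `lam`,
    -- first.
    ((Equiv.prodComm _ _).trans (splitEquiv lam mu).symm) fun σ x => ?_
  rw [Equiv.trans_apply, Equiv.symm_apply_eq]
  exact (congrArg (σ • ·) ((splitEquiv lam mu).apply_symm_apply x.swap)).symm

end PermModule

end

end StrictPoly

open StrictPoly StrictPoly.SPF in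
theorem corollary3p13 {k : Type u} [CommRing k] {d m n : ℕ}
    (lam : Weight m d) (mu : Weight n d) :
    Nonempty (internalTensor (Gam k lam) (Wedge k mu) ≅
      directSum fun nu : Weight.Matrices mu lam => Wedge k (Weight.ofMatrix nu)) ∧
    Nonempty (internalTensor (Gam k lam) (Symm k mu) ≅
      directSum fun nu : Weight.Matrices mu lam => Symm k (Weight.ofMatrix nu)) ∧
    Nonempty (internalTensor (Wedge k lam) (Wedge k mu) ≅
      directSum fun nu : Weight.Matrices mu lam => Symm k (Weight.ofMatrix nu)) ∧
    Nonempty (internalTensor (Symm k lam) (Symm k mu) ≅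
      directSum fun nu : Weight.Matrices mu lam => Symm k (Weight.ofMatrix nu)) ∧
    (IsUnit (2 : k) → Nonempty (internalTensor (Symm k lam) (Wedge k mu) ≅
      directSum fun nu : Weight.Matrices mu lam => Wedge k (Weight.ofMatrix nu))) ∧
    ((2 : k) = 0 → Nonempty (internalTensor (Symm k lam) (Wedge k mu) ≅
      directSum fun nu : Weight.Matrices mu lam => Symm k (Weight.ofMatrix nu))) ∧
    Nonempty (((permModule k mu).tprod (permModule k lam)).Equiv
      (Representation.directSum fun nu : Weight.Matrices mu lam =>
        permModule k (Weight.ofMatrix nu))) :=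
  ⟨nonempty_gam_wedge lam mu, nonempty_gam_symm lam mu, nonempty_wedge_wedge lam mu,
    nonempty_symm_symm lam mu, nonempty_symm_wedge_of_isUnit lam mu,
    nonempty_symm_wedge_of_two_eq_zero lam mu, nonempty_permModule_tprod lam mu⟩
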